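/- Let $G=(V,E)$ be a finite connected simple graph with at least two vertices and without cycles of length $3$, $4$ or $5$ (trees allowed). For a positive weight $\omega:E\to(0,\infty)$ and $0<\alpha<1$ put $m(x)=\sum_{y\sim x}\omega_{xy}$, let $m_x^\alpha$ be the probability measure on $V$ with $m_x^\alpha(x)=\alpha$, $m_x^\alpha(y)=(1-\alpha)\,\omega_{xy}/m(x)$ for $y\sim x$, and $m_x^\alpha(y)=0$ otherwise. For an edge $e=xy$ let $$\kappa_e(\omega)=\lim_{\alpha\to1^-}\frac{1}{1-\alpha}\left(1-\frac{W(m_x^\alpha,m_y^\alpha)}{d(x,y)}\right)$$ be its Lin--Lu--Yau curvature, where $d$ is the combinatorial graph distance and $W$ the Wasserstein ($L^1$ transport) distance for $d$. For every positive weight $\omega$ the average curvature $\frac1{|E|}\sum_{e}\kappa_e(\omega)$ equals the constant $\bar\kappa=2\left(\frac{|V|}{|E|}-1\right)$. Consider the density condition $$\max_{\emptyset\neq\Omega\subsetneq V}\frac{|E(\Omega)|}{|\Omega|}<\frac{|E|}{|V|},\qquad(\ast)$$ where $E(\Omega)$ is the edge set of the subgraph induced by $\Omega$. Convergence is as $t\to\infty$,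 and exponential convergence means a bound $Ce^{-ct}$ on the difference for all edges and all $t\ge0$, with constants $C$ and $c>0$ that may depend on the solution. Let $\omega_0$ be any positive weight. 1. The flow $\frac{d}{dt}\omega_e=-(\kappa_e(\omega)-\bar\kappa)\,\omega_e$, $\omega(0)=\omega_0$, has a positive solution on $[0,\infty)$, and any such solution converges exponentially to a positive weight with $\kappa_e=\bar\kappa$ for all $e\in E$ if and only if $(\ast)$ holds. 2. The unnormalized flow $\frac{d}{dt}\omega_e=-\kappa_e(\omega)\,\omega_e$, $\omega(0)=\omega_0$, has a positive solution on $[0,\infty)$, and along any such solution the curvatures $\kappa_e(\omega(t))$, $e\in E$, converge exponentially to $\bar\kappa$ if and only if $(\ast)$ holds. 3. If $\sum_e\omega_0(e)=1$, the normalized flow $\frac{d}{dt}\omega_e=-\kappa_e(\omega)\,\omega_e+\omega_e\sum_{h\in E}\kappa_h(\omega)\,\omega_h$, $\omega(0)=\omega_0$, has a positive solution on $[0,\infty)$; any such solution converges exponentially to a positive weight of total mass $1$ with $\kappa_e=\bar\kappa$ for all $e\in E$ if and only if $(\ast)$ holds, and along it the curvatures converge exponentially to $\bar\kappa$ if and only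 if $(\ast)$ holds. -/

import Mathlib

open Filter Topology

namespace LinLuYau

noncomputable section

variable {V : Type*} [Fintype V]

/-- `A` is a transport plan (coupling) from `μ` to `ν`. -/
def IsTransportPlan (μ ν : V → ℝ) (A : V → V → ℝ) : Prop :=
  (∀ u v, A u v ∈ Set.Icc (0 : ℝ) 1) ∧ (∀ u, ∑ v, A u v = μ u) ∧ (∀ v, ∑ u, A u v = ν v)

/-- The Wasserstein distance between `μ` and `ν` for the combinatorial graph distance. -/
def wasserstein (G : SimpleGraph V) (μ ν : V → ℝ) : ℝ :=
  sInf {c : ℝ | ∃ A : V → V → ℝ, IsTransportPlan μ ν A ∧ c = ∑ u, ∑ v, (G.dist u v : ℝ) * A u v}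

theorem wasserstein_comm (G : SimpleGraph V) (μ ν : V → ℝ) :
    wasserstein G μ ν = wasserstein G ν μ := by
  have key : ∀ μ ν : V → ℝ,
      {c : ℝ | ∃ A : V → V → ℝ, IsTransportPlan μ ν A ∧
        c = ∑ u, ∑ v, (G.dist u v : ℝ) * A u v} ⊆
      {c : ℝ | ∃ A : V → V → ℝ, IsTransportPlan ν μ A ∧
        c = ∑ u, ∑ v, (G.dist u v : ℝ) * A u v} := by
    rintro μ ν c ⟨A, ⟨h1, h2, h3⟩, rfl⟩
    refine ⟨fun u v => A v u, ⟨fun u v => h1 v u, h3, h2⟩, ?_⟩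
    rw [Finset.sum_comm]
    simp only [G.dist_comm]
  unfold wasserstein
  rw [Set.Subset.antisymm (key μ ν) (key ν μ)]

variable [DecidableEq V] (G : SimpleGraph V) [DecidableRel G.Adj]

/-- The weight `ω_{xy}` of the edge `xy`, and `0` if `x` and `y` are not adjacent. -/
def wt (ω : G.edgeSet → ℝ) (x y : V) : ℝ :=
  if h : G.Adj x y then ω ⟨s(x, y), h⟩ else 0

/-- The weighted degree `m(x) = ∑_{y ∼ x} ω_{xy}`. -/
def vertexMass (ω : G.edgeSet → ℝ) (x : V) : ℝ := ∑ y, wt G ω x y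

/-- The lazy random walk measure `m_x^α`. -/
def lazyMeasure (ω : G.edgeSet → ℝ) (α : ℝ) (x y : V) : ℝ :=
  if y = x then α else if G.Adj x y then (1 - α) * (wt G ω x y / vertexMass G ω x) else 0

/-- The Lin–Lu–Yau curvature `κ(x, y)`. -/
def curvature (ω : G.edgeSet → ℝ) (x y : V) : ℝ :=
  limUnder (𝓝[<] (1 : ℝ)) fun α : ℝ =>
    1 / (1 - α) *
      (1 - wasserstein G (lazyMeasure G ω α x) (lazyMeasure G ω α y) / (G.dist x y : ℝ))

theorem curvature_comm (ω : G.edgeSet → ℝ) (x y : V) :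
    curvature G ω x y = curvature G ω y x := by
  unfold curvature
  simp only [wasserstein_comm G _ (lazyMeasure G ω _ y), G.dist_comm (u := x)]

/-- The Lin–Lu–Yau curvature `κ_e` of an edge. -/
def edgeCurvature (ω : G.edgeSet → ℝ) (e : G.edgeSet) : ℝ :=
  Sym2.lift ⟨curvature G ω, curvature_comm G ω⟩ e.1

/-- The constant `2 (|V| / |E| - 1)`. -/
def avgCurvature : ℝ :=
  2 * ((Fintype.card V : ℝ) / (G.edgeFinset.card : ℝ) - 1)

/-- `|E(Ω)| / |Ω| < |E| / |V|` for every nonempty proper subset `Ω` of `V`, where `E(Ω)` is the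
edge set of the induced subgraph on `Ω`. -/
def DensityCondition : Prop :=
  ∀ Ω : Finset V, Ω.Nonempty → Ω ≠ Finset.univ →
    ((G.induce (Ω : Set V)).edgeSet.ncard : ℝ) / (Ω.card : ℝ) <
      (G.edgeFinset.card : ℝ) / (Fintype.card V : ℝ)

variable {G} in
/-- `ω` is a positive solution on `[0, ∞)` of `dω/dt = F(ω)`, `ω(0) = ω₀`. -/
structure IsPositiveSolution (F : (G.edgeSet → ℝ) → G.edgeSet → ℝ) (ω₀ : G.edgeSet → ℝ)
    (ω : ℝ → G.edgeSet → ℝ) : Prop where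
  initial : ω 0 = ω₀
  pos : ∀ t, 0 ≤ t → ∀ e, 0 < ω t e
  cont : ContinuousOn ω (Set.Ici 0)
  deriv : ∀ t, 0 < t → ∀ e, HasDerivAt (fun s => ω s e) (F (ω t) e) t

/-- Right-hand side of the constant curvature flow `dω_e/dt = -(κ_e - κ̄) ω_e`. -/
def constantCurvatureField (ω : G.edgeSet → ℝ) (e : G.edgeSet) : ℝ :=
  -(edgeCurvature G ω e - avgCurvature G) * ω e

/-- Right-hand side of the unnormalized flow `dω_e/dt = -κ_e ω_e`. -/
def unnormalizedField (ω : G.edgeSet → ℝ) (e : G.edgeSet) : ℝ :=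
  -edgeCurvature G ω e * ω e

/-- Right-hand side of the normalized flow `dω_e/dt = -κ_e ω_e + ω_e ∑_h κ_h ω_h`. -/
def normalizedField (ω : G.edgeSet → ℝ) (e : G.edgeSet) : ℝ :=
  -(ω e * edgeCurvature G ω e) + ω e * ∑ h, edgeCurvature G ω h * ω h

/-- `u(t)` converges exponentially to `l` as `t → ∞`. -/
def ConvergesExp {ι : Type*} (u : ℝ → ι → ℝ) (l : ι → ℝ) : Prop :=
  ∃ C c : ℝ, 0 < c ∧ ∀ t, 0 ≤ t → ∀ i, |u t i - l i| ≤ C * Real.exp (-(c * t))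

/-- `ω` is a (positive) weight of constant curvature `κ̄`. -/
def IsConstantCurvatureWeight (ω : G.edgeSet → ℝ) : Prop :=
  (∀ e, 0 < ω e) ∧ ∀ e, edgeCurvature G ω e = avgCurvature G

end

end LinLuYau

set_option linter.unusedSectionVars false

/-! Girth at least six makes the optimal transport between the two lazy measures of an edge $xy$
explicit, and $\kappa_{xy}=2(\omega_{xy}/m(x)+\omega_{xy}/m(y)-1)$ (`curvature_eq`). In coordinates
$s=\log\omega$ the sum of the two quotients is the `load` of the edge: every vertex distributes one
unit over its star in proportion to $e^{s}$. Hence the loads sum to $|V|$, which gives the average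
curvature, and constant curvature means that every load equals $\rho=|V|/|E|$. All three flows read
$s_e'=-2(\mathrm{load}_e-\rho)+\nu$ with $\nu$ independent of $e$. Loads ignore a common shift of
$s$, so after subtracting the mean the three flows coincide. The field is bounded and globally
Lipschitz, which gives global solutions. It is also $-2$ times the gradient of the convex potential
$\Phi(s)=\sum_x\log m(x)-\rho\sum_e s_e$. A balanced weight exists exactly under $(\ast)$. Under
$(\ast)$ a layer-cake argument makes $\Phi$ coercive modulo constants, so it has a minimum
(`EdgeDensityCondition.exists_load_eq`); conversely, counting the load inside $\Omega$ gives
$(\ast)$ (`densityCondition_of_load_eq`). Around a balanced weight, strong monotonicity of the load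
and a Poincaré inequality from connectedness yield exponential decay
(`IsLoadFlow.exists_abs_sub_le_exp`). If instead the curvatures converge exponentially, the centred
logarithms have integrable speed, so they converge to a balanced weight
(`IsLoadFlow.exists_load_eq`). -/

namespace LinLuYau

/-! ### The load of an edge as a function of the logarithmic weight -/

section StarLoad

variable {V E : Type*} [Fintype V] [Fintype E] [DecidableEq E] (I : V → Finset E)

/-- Total mass of the weight `exp s` on the star `I x`. -/
noncomputable def starMass (s : E → ℝ) (x : V) : ℝ := ∑ e ∈ I x, Real.exp (s e)

/-- The share of `e` in the mass of the star `I x`. -/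
noncomputable def starProb (s : E → ℝ) (x : V) (e : E) : ℝ :=
  if e ∈ I x then Real.exp (s e) / starMass I s x else 0

/-- The sum of the shares of `e` in all stars. -/
noncomputable def load (s : E → ℝ) (e : E) : ℝ := ∑ x, starProb I s x e

variable {I}

theorem starMass_pos {x : V} (hx : (I x).Nonempty) (s : E → ℝ) : 0 < starMass I s x :=
  Finset.sum_pos (fun _ _ => Real.exp_pos _) hx

theorem exp_le_starMass {x : V} {e : E} (he : e ∈ I x) (s : E → ℝ) :
    Real.exp (s e) ≤ starMass I s x :=
  Finset.single_le_sum (f := fun e => Real.exp (s e)) (fun _ _ => (Real.exp_pos _).le) he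

theorem starProb_pos {x : V} {e : E} (he : e ∈ I x) (s : E → ℝ) : 0 < starProb I s x e := by
  rw [starProb, if_pos he]
  exact div_pos (Real.exp_pos _) (starMass_pos ⟨e, he⟩ s)

theorem starProb_nonneg (s : E → ℝ) (x : V) (e : E) : 0 ≤ starProb I s x e := by
  by_cases he : e ∈ I x
  · exact (starProb_pos he s).le
  · simp [starProb, he]

theorem starProb_le_one (s : E → ℝ) (x : V) (e : E) : starProb I s x e ≤ 1 := by
  by_cases he : e ∈ I x
  · rw [starProb, if_pos he, div_le_one (starMass_pos ⟨e, he⟩ s)]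
    exact exp_le_starMass he s
  · simp [starProb, he]

theorem sum_starProb {x : V} (hx : (I x).Nonempty) (s : E → ℝ) : ∑ e, starProb I s x e = 1 := by
  simp only [starProb, Finset.sum_ite_mem, Finset.univ_inter]
  rw [← Finset.sum_div]
  exact div_self (starMass_pos hx s).ne'

theorem sum_load (hI : ∀ x, (I x).Nonempty) (s : E → ℝ) :
    ∑ e, load I s e = Fintype.card V := by
  simp only [load]
  rw [Finset.sum_comm]
  simp [sum_starProb (hI _)]

theorem load_nonneg (s : E → ℝ) (e : E) : 0 ≤ load I s e :=
  Finset.sum_nonneg fun _ _ => starProb_nonneg _ _ _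

theorem load_le_card (s : E → ℝ) (e : E) : load I s e ≤ Fintype.card V := by
  refine (Finset.sum_le_sum fun x _ => starProb_le_one s x e).trans ?_
  simp

theorem starProb_add_const (s : E → ℝ) (c : ℝ) (x : V) (e : E) :
    starProb I (fun f => s f + c) x e = starProb I s x e := by
  have hm : starMass I (fun f => s f + c) x = starMass I s x * Real.exp c := by
    simp only [starMass, Finset.sum_mul, Real.exp_add]
  simp only [starProb, hm, Real.exp_add]
  rw [mul_div_mul_right _ _ (Real.exp_pos c).ne']

theorem load_add_const (s : E → ℝ) (c : ℝ) (e : E) :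
    load I (fun f => s f + c) e = load I s e := by
  simp only [load, starProb_add_const]

/-- Shares change by the factor `exp (v e)`, up to a normalization bounded below. -/
theorem exists_starProb_eq_mul {R : ℝ} (u v : E → ℝ) (hv : ∀ e, |v e| ≤ R) (x : V) :
    ∃ k, Real.exp (-R) ≤ k ∧
      ∀ e, starProb I (u + v) x e = k * (starProb I u x e * Real.exp (v e)) := by
  rcases (I x).eq_empty_or_nonempty with h | h
  · exact ⟨_, le_rfl, fun e => by simp [starProb, h]⟩
  have hA := starMass_pos h u
  have hB := starMass_pos h (u + v)
  -- The normalization is the ratio of the star masses; the new mass is at most `exp R` times the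
  -- old.
  refine ⟨starMass I u x / starMass I (u + v) x, ?_, fun e => ?_⟩
  · rw [le_div_iff₀ hB]
    simp only [starMass, Finset.mul_sum, ← Real.exp_add]
    refine Finset.sum_le_sum fun e _ => Real.exp_le_exp.2 ?_
    have := (abs_le.1 (hv e)).2
    simp only [Pi.add_apply]
    linarith
  · simp only [starProb, Pi.add_apply, Real.exp_add]
    split_ifs
    · field_simp
    · simp

/-- A share shrinks at most by the factor `exp (-2‖s - t‖) ≥ 1 - 2‖s - t‖`, one exponential coming
from the normalization and one from the edge itself. Exchanging `s` and `t` gives the other side. -/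
theorem starProb_sub_le (s t : E → ℝ) (x : V) (e : E) :
    starProb I s x e - starProb I t x e ≤ 2 * ‖s - t‖ := by
  obtain ⟨k, hk, h⟩ := exists_starProb_eq_mul (I := I) s (t - s) (R := ‖s - t‖)
    (fun e => by rw [norm_sub_rev]; exact norm_le_pi_norm (t - s) e) x
  have he := h e
  rw [add_sub_cancel] at he
  have h1 : Real.exp (-‖s - t‖) ≤ Real.exp ((t - s) e) := by
    refine Real.exp_le_exp.2 ?_
    have := (abs_le.1 (norm_le_pi_norm (t - s) e)).1
    rwa [norm_sub_rev] at this
  have h2 : 1 - 2 * ‖s - t‖ ≤ Real.exp (-‖s - t‖) * Real.exp (-‖s - t‖) := by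
    rw [← Real.exp_add]
    have := Real.add_one_le_exp (-‖s - t‖ + -‖s - t‖)
    linarith
  have h3 : Real.exp (-‖s - t‖) * Real.exp (-‖s - t‖) ≤ k * Real.exp ((t - s) e) :=
    mul_le_mul hk h1 (Real.exp_pos _).le ((Real.exp_pos _).le.trans hk)
  have h4 := starProb_nonneg (I := I) s x e
  have h5 := starProb_le_one (I := I) s x e
  have h6 := mul_le_mul_of_nonneg_left (h2.trans h3) h4
  have h7 := mul_le_mul_of_nonneg_right h5 (norm_nonneg (s - t))
  nlinarith

theorem abs_load_sub_le (s t : E → ℝ) (e : E) :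
    |load I s e - load I t e| ≤ 2 * Fintype.card V * ‖s - t‖ := by
  simp only [load, ← Finset.sum_sub_distrib]
  refine (Finset.abs_sum_le_sum_abs _ _).trans ?_
  refine (Finset.sum_le_sum fun x _ => abs_sub_le_iff.2
    ⟨starProb_sub_le s t x e, ?_⟩ : _ ≤ ∑ _x : V, 2 * ‖s - t‖).trans ?_
  · rw [norm_sub_rev]
    exact starProb_sub_le t s x e
  · simp only [Finset.sum_const, Finset.card_univ, nsmul_eq_mul]
    linarith

theorem continuous_load (e : E) : Continuous fun s : E → ℝ => load I s e := by
  have : LipschitzWith (2 * Fintype.card V) fun s : E → ℝ => load I s e :=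
    LipschitzWith.of_dist_le_mul fun s t => by
      rw [Real.dist_eq, dist_eq_norm]
      exact_mod_cast abs_load_sub_le s t e
  exact this.continuous

/-! ### Monotonicity -/

/-- The quadratic form `∑ₓ ∑_{e,f} p_x(e) p_x(f) (v_e - v_f)²` for the shares `p` of `u`. -/
noncomputable def starForm (I : V → Finset E) (u v : E → ℝ) : ℝ :=
  ∑ x, ∑ e, ∑ f, starProb I u x e * starProb I u x f * (v e - v f) ^ 2

theorem starForm_nonneg (u v : E → ℝ) : 0 ≤ starForm I u v :=
  Finset.sum_nonneg fun _ _ => Finset.sum_nonneg fun _ _ => Finset.sum_nonneg fun _ _ =>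
    mul_nonneg (mul_nonneg (starProb_nonneg _ _ _) (starProb_nonneg _ _ _)) (sq_nonneg _)

theorem exp_mul_sq_le {R a b : ℝ} (ha : |a| ≤ R) (hb : |b| ≤ R) :
    Real.exp (-R) * (a - b) ^ 2 ≤ (a - b) * (Real.exp a - Real.exp b) := by
  wlog hab : b ≤ a generalizing a b
  · have := this hb ha (le_of_not_ge hab)
    linarith
  have h1 : Real.exp (-R) ≤ Real.exp b := Real.exp_le_exp.2 (abs_le.1 hb).1
  have h2 : Real.exp b * (a - b) ≤ Real.exp a - Real.exp b := by
    have := Real.add_one_le_exp (a - b)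
    have h3 : Real.exp a = Real.exp b * Real.exp (a - b) := by
      rw [← Real.exp_add]; congr 1; ring
    rw [h3]
    nlinarith [Real.exp_pos b]
  have h4 : 0 ≤ a - b := sub_nonneg.2 hab
  nlinarith [mul_le_mul_of_nonneg_right h1 h4]

/-- Strong monotonicity of the load, uniform on balls. Shares sum to one in each star, so $\sum
v(p-q)$ antisymmetrizes to $\frac12\sum(v_e-v_f)(p_eq_f-q_ep_f)$. With $p_e=kq_ee^{v_e}$ each term
is $kq_eq_f(v_e-v_f)(e^{v_e}-e^{v_f})$; $k$ and the monotonicity of exp each cost one factor `exp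
(-R)`. -/
theorem starForm_le_sum_load_sub (hI : ∀ x, (I x).Nonempty) {R : ℝ} (u v : E → ℝ)
    (hv : ∀ e, |v e| ≤ R) :
    Real.exp (-R) * Real.exp (-R) / 2 * starForm I u v ≤
      ∑ e, v e * (load I (u + v) e - load I u e) := by
  have hr : ∑ e, v e * (load I (u + v) e - load I u e) =
      ∑ x, ∑ e, v e * (starProb I (u + v) x e - starProb I u x e) := by
    simp only [load, ← Finset.sum_sub_distrib, Finset.mul_sum]
    rw [Finset.sum_comm]
  rw [hr, starForm, Finset.mul_sum]
  refine Finset.sum_le_sum fun x _ => ?_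
  set p := starProb I (u + v) x
  set q := starProb I u x
  have hp : ∑ f, p f = 1 := sum_starProb (hI x) _
  have hq : ∑ f, q f = 1 := sum_starProb (hI x) _
  have h1 : ∑ e, v e * (p e - q e) = ∑ e, ∑ f, v e * (p e * q f - q e * p f) := by
    refine Finset.sum_congr rfl fun e _ => ?_
    rw [← Finset.mul_sum, Finset.sum_sub_distrib, ← Finset.mul_sum, ← Finset.mul_sum, hp, hq,
      mul_one, mul_one]
  have h2 : ∑ e, v e * (p e - q e) =
      1 / 2 * ∑ e, ∑ f, (v e - v f) * (p e * q f - q e * p f) := by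
    have h3 : ∑ e, v e * (p e - q e) = ∑ e, ∑ f, v f * (p f * q e - q f * p e) := by
      rw [h1, Finset.sum_comm]
    have h4 : ∑ e, ∑ f, (v e - v f) * (p e * q f - q e * p f) =
        ∑ e, ∑ f, v e * (p e * q f - q e * p f) + ∑ e, ∑ f, v f * (p f * q e - q f * p e) := by
      simp only [← Finset.sum_add_distrib]
      refine Finset.sum_congr rfl fun e _ => Finset.sum_congr rfl fun f _ => by ring
    rw [h4, ← h1, ← h3]
    ring
  have h3 : ∀ a b : ℝ, a / 2 * b = 1 / 2 * (a * b) := fun a b => by ring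
  rw [h2, h3]
  refine mul_le_mul_of_nonneg_left ?_ (by norm_num)
  simp only [Finset.mul_sum]
  refine Finset.sum_le_sum fun e _ => Finset.sum_le_sum fun f _ => ?_
  obtain ⟨k, hk, h⟩ := exists_starProb_eq_mul (I := I) u v hv x
  have hqe : 0 ≤ q e := starProb_nonneg _ _ _
  have hqf : 0 ≤ q f := starProb_nonneg _ _ _
  have hpe : p e = k * (q e * Real.exp (v e)) := h e
  have hpf : p f = k * (q f * Real.exp (v f)) := h f
  have hm := exp_mul_sq_le (hv e) (hv f)
  have h0 : 0 ≤ Real.exp (-R) * (v e - v f) ^ 2 := by positivity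
  have h5 := mul_le_mul hk hm h0 ((Real.exp_pos _).le.trans hk)
  have h6 := mul_le_mul_of_nonneg_left h5 (mul_nonneg hqe hqf)
  rw [hpe, hpf]
  calc _ = q e * q f * (Real.exp (-R) * (Real.exp (-R) * (v e - v f) ^ 2)) := by ring
    _ ≤ _ := h6
    _ = _ := by ring

/-- Two edges in a common star contribute their squared difference to the form with a positive
coefficient; a chain of such edges joins any `e` to any `f`. -/
theorem exists_sq_sub_le_starForm
    (hconn : ∀ e f, Relation.ReflTransGen (fun e f => ∃ x, e ∈ I x ∧ f ∈ I x) e f)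
    (u : E → ℝ) (e f : E) : ∃ C, 0 ≤ C ∧ ∀ v : E → ℝ, (v e - v f) ^ 2 ≤ C * starForm I u v := by
  induction hconn e f with
  | refl => exact ⟨0, le_rfl, fun v => by simp⟩
  | @tail g h _ hgh ih =>
    obtain ⟨C, hC, ihC⟩ := ih
    obtain ⟨x, hg, hh⟩ := hgh
    have hpq := mul_pos (starProb_pos hg u) (starProb_pos hh u)
    refine ⟨2 * C + 2 / (starProb I u x g * starProb I u x h), by positivity, fun v => ?_⟩
    have h1 : starProb I u x g * starProb I u x h * (v g - v h) ^ 2 ≤ starForm I u v := by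
      have hn : ∀ x e f, 0 ≤ starProb I u x e * starProb I u x f * (v e - v f) ^ 2 :=
        fun x e f => mul_nonneg
          (mul_nonneg (starProb_nonneg _ _ _) (starProb_nonneg _ _ _)) (sq_nonneg _)
      refine (Finset.single_le_sum (f := fun f =>
        starProb I u x g * starProb I u x f * (v g - v f) ^ 2)
        (fun f _ => hn x g f) (Finset.mem_univ h)).trans ?_
      refine (Finset.single_le_sum (f := fun e =>
        ∑ f, starProb I u x e * starProb I u x f * (v e - v f) ^ 2)
        (fun e _ => Finset.sum_nonneg fun f _ => hn x e f) (Finset.mem_univ g)).trans ?_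
      exact Finset.single_le_sum (f := fun x =>
        ∑ e, ∑ f, starProb I u x e * starProb I u x f * (v e - v f) ^ 2)
        (fun x _ => Finset.sum_nonneg fun e _ => Finset.sum_nonneg fun f _ => hn x e f)
        (Finset.mem_univ x)
    have h2 : (v g - v h) ^ 2 ≤ starForm I u v / (starProb I u x g * starProb I u x h) := by
      rw [le_div_iff₀ hpq, mul_comm]
      exact h1
    have h3 := ihC v
    have h4 : (v e - v h) ^ 2 ≤ 2 * (v e - v g) ^ 2 + 2 * (v g - v h) ^ 2 := by
      nlinarith [sq_nonneg (v e - v g - (v g - v h))]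
    calc _ ≤ _ := h4
      _ ≤ 2 * (C * starForm I u v) +
          2 * (starForm I u v / (starProb I u x g * starProb I u x h)) := by gcongr
      _ = _ := by ring

/-- Poincaré inequality for the star form. -/
theorem exists_sum_sq_le_starForm [Nonempty E]
    (hconn : ∀ e f, Relation.ReflTransGen (fun e f => ∃ x, e ∈ I x ∧ f ∈ I x) e f)
    (u : E → ℝ) :
    ∃ C, 0 < C ∧ ∀ v : E → ℝ, ∑ e, v e = 0 → ∑ e, v e ^ 2 ≤ C * starForm I u v := by
  choose C hC h using exists_sq_sub_le_starForm hconn u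
  have hS : 0 ≤ ∑ e, ∑ f, C e f :=
    Finset.sum_nonneg fun e _ => Finset.sum_nonneg fun f _ => hC e f
  refine ⟨∑ e, ∑ f, C e f + 1, by linarith, fun v hv => ?_⟩
  have h1 : ∑ e, ∑ f, (v e - v f) ^ 2 ≤ (∑ e, ∑ f, C e f) * starForm I u v := by
    simp only [Finset.sum_mul]
    exact Finset.sum_le_sum fun e _ => Finset.sum_le_sum fun f _ => h e f v
  -- The cross terms vanish because `v` has mean zero.
  have h2 : ∑ e, ∑ f, (v e - v f) ^ 2 = 2 * Fintype.card E * ∑ e, v e ^ 2 := by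
    have : ∀ e f, (v e - v f) ^ 2 = v e ^ 2 - 2 * v e * v f + v f ^ 2 := fun e f => by ring
    simp only [this, Finset.sum_add_distrib, Finset.sum_sub_distrib, ← Finset.mul_sum, hv]
    simp only [Finset.sum_const, Finset.card_univ, nsmul_eq_mul, ← Finset.mul_sum, mul_zero]
    ring
  have hc : (1 : ℝ) ≤ Fintype.card E := by exact_mod_cast Fintype.card_pos
  have hs : 0 ≤ ∑ e, v e ^ 2 := Finset.sum_nonneg fun e _ => sq_nonneg _
  have := starForm_nonneg (I := I) u v
  nlinarith

end StarLoad

end LinLuYau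

namespace LinLuYau

section StarLoad

variable {V E : Type*} [Fintype V] [Fintype E] [DecidableEq E] {I : V → Finset E}

/-! ### Existence of a balanced weight -/

variable (V E) in
/-- The mean load `|V| / |E|`. -/
noncomputable def meanLoad : ℝ := Fintype.card V / Fintype.card E

variable (I) in
/-- Every nonempty proper set `F` of edges touches more than `(|V| / |E|) |F|` vertices. -/
def EdgeDensityCondition : Prop :=
  ∀ F : Finset E, F.Nonempty → F ≠ Finset.univ →
    (meanLoad V E * F.card : ℝ) < (Finset.univ.filter fun x => ∃ e ∈ F, e ∈ I x).card

/-- There are finitely many edge sets, so the strict inequalities have a common slack; it becomes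
the coercivity constant of the potential. -/
theorem EdgeDensityCondition.exists_gap (h : EdgeDensityCondition I) :
    ∃ δ : ℝ, 0 < δ ∧ ∀ F : Finset E, F.Nonempty → F ≠ Finset.univ →
      meanLoad V E * F.card + δ ≤ (Finset.univ.filter fun x => ∃ e ∈ F, e ∈ I x).card := by
  let S : Finset (Finset E) := Finset.univ.filter fun F => F.Nonempty ∧ F ≠ Finset.univ
  let g : Finset E → ℝ := fun F =>
    (Finset.univ.filter fun x => ∃ e ∈ F, e ∈ I x).card - meanLoad V E * F.card
  rcases S.eq_empty_or_nonempty with hS | hS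
  · refine ⟨1, one_pos, fun F h1 h2 => ?_⟩
    have : F ∈ S := by simp [S, h1, h2]
    simp [hS] at this
  · obtain ⟨F₀, hF₀, hmin⟩ := S.exists_min_image g hS
    have hF₀' := (Finset.mem_filter.1 hF₀).2
    refine ⟨g F₀, sub_pos.2 (h F₀ hF₀'.1 hF₀'.2), fun F h1 h2 => ?_⟩
    have := hmin F (by simp [S, h1, h2])
    have hg : g F = (Finset.univ.filter fun x => ∃ e ∈ F, e ∈ I x).card - meanLoad V E * F.card :=
      rfl
    linarith

/-- Layer-cake inequality: `w` majorizes on each vertex the values of `v` on the edges there. -/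
theorem mul_le_sum_sub_of_gap {δ : ℝ} (hδ : 0 ≤ δ)
    (h : ∀ F : Finset E, F.Nonempty → F ≠ Finset.univ →
      meanLoad V E * F.card + δ ≤ (Finset.univ.filter fun x => ∃ e ∈ F, e ∈ I x).card)
    (v : E → ℝ) (w : V → ℝ) (hv : ∀ e, 0 ≤ v e) (hv0 : ∃ e, v e = 0) (hw : ∀ x, 0 ≤ w x)
    (hvw : ∀ x, ∀ e ∈ I x, v e ≤ w x) (e : E) :
    δ * v e ≤ ∑ x, w x - meanLoad V E * ∑ f, v f := by
  classical
  induction hn : (Finset.univ.filter fun f => 0 < v f).card using Nat.strong_induction_on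
    generalizing v w with
  | _ n ih =>
  rcases (Finset.univ.filter fun f => 0 < v f).eq_empty_or_nonempty with hF | hF
  · have hz : ∀ f, v f = 0 := fun f => by
      have : f ∉ Finset.univ.filter fun f => 0 < v f := by simp [hF]
      simp only [Finset.mem_filter, Finset.mem_univ, true_and, not_lt] at this
      exact le_antisymm this (hv f)
    simp only [hz, mul_zero, Finset.sum_const_zero, sub_zero]
    exact Finset.sum_nonneg fun x _ => hw x
  set F := Finset.univ.filter fun f => 0 < v f with hFdef
  have hmem : ∀ f, f ∈ F ↔ 0 < v f := fun f => by simp [hFdef]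
  obtain ⟨g, hgF, hg⟩ := F.exists_min_image v hF
  have hm : 0 < v g := (hmem g).1 hgF
  have hFne : F ≠ Finset.univ := by
    obtain ⟨f, hf⟩ := hv0
    intro hu
    have : f ∈ F := hu ▸ Finset.mem_univ f
    rw [hmem, hf] at this
    exact lt_irrefl _ this
  have hgap := h F hF hFne
  set U := Finset.univ.filter fun x => ∃ e ∈ F, e ∈ I x with hU
  -- Peel off one layer: lower `v` on its support `F` by its least positive value, and `w` by the
  -- same amount on the vertices `U` touched by `F`. The gap inequality for `F`, times `v g`,
  -- accounts for the layer, and `g` leaves the support.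
  let v' : E → ℝ := fun f => v f - if f ∈ F then v g else 0
  let w' : V → ℝ := fun x => w x - if x ∈ U then v g else 0
  have hv' : ∀ f, 0 ≤ v' f := fun f => by
    simp only [v']
    split_ifs with hf
    · exact sub_nonneg.2 (hg f hf)
    · simpa using hv f
  have hsub : (Finset.univ.filter fun f => 0 < v' f) ⊂ F := by
    refine (Finset.ssubset_iff_of_subset fun f hf => ?_).2 ⟨g, hgF, by simp [v', hgF]⟩
    rw [Finset.mem_filter] at hf
    rw [hmem]
    refine hf.2.trans_le ?_
    simp only [v']
    split_ifs <;> linarith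
  have hvw' : ∀ x, ∀ f ∈ I x, v' f ≤ w' x := fun x f hf => by
    simp only [v', w']
    by_cases hfF : f ∈ F
    · have : x ∈ U := by rw [hU, Finset.mem_filter]; exact ⟨Finset.mem_univ _, f, hfF, hf⟩
      rw [if_pos hfF, if_pos this]
      linarith [hvw x f hf]
    · have h0 : v f = 0 := le_antisymm (not_lt.1 (mt (hmem f).2 hfF)) (hv f)
      rw [if_neg hfF, h0]
      split_ifs with hx
      · obtain ⟨f', hf', hf'x⟩ := (Finset.mem_filter.1 hx).2
        linarith [hvw x f' hf'x, hg f' hf']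
      · linarith [hw x]
  have hw' : ∀ x, 0 ≤ w' x := fun x => by
    simp only [w']
    split_ifs with hx
    · obtain ⟨f', hf', hf'x⟩ := (Finset.mem_filter.1 hx).2
      linarith [hvw x f' hf'x, hg f' hf']
    · linarith [hw x]
  have hv0' : ∃ f, v' f = 0 := ⟨g, by simp [v', hgF]⟩
  have key := ih _ (hn ▸ Finset.card_lt_card hsub) v' w' hv' hv0' hw' hvw' rfl
  have hsw : ∑ x, w' x = ∑ x, w x - U.card * v g := by
    simp only [w', Finset.sum_sub_distrib, Finset.sum_ite_mem, Finset.univ_inter,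
      Finset.sum_const, nsmul_eq_mul]
  have hsv : ∑ f, v' f = ∑ f, v f - F.card * v g := by
    simp only [v', Finset.sum_sub_distrib, Finset.sum_ite_mem, Finset.univ_inter,
      Finset.sum_const, nsmul_eq_mul]
  rw [hsw, hsv] at key
  have h1 := mul_le_mul_of_nonneg_right hgap hm.le
  have h2 : v e ≤ v' e + v g := by
    simp only [v']
    split_ifs <;> linarith
  have h3 := mul_le_mul_of_nonneg_left h2 hδ
  linarith

variable (I) in
/-- The convex potential whose gradient is the deviation of the load from its mean. -/
noncomputable def starPotential (s : E → ℝ) : ℝ :=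
  ∑ x, Real.log (starMass I s x) - meanLoad V E * ∑ e, s e

theorem meanLoad_mul_card [Nonempty E] : meanLoad V E * Fintype.card E = Fintype.card V :=
  div_mul_cancel₀ _ (Nat.cast_ne_zero.2 Fintype.card_ne_zero)

/-- Coercivity: the potential controls the oscillation of `s`. The logarithm of a star mass
dominates every `s e` in the star, so the layer-cake inequality applies to `s` minus its minimum;
the shift cancels because $\rho|E|=|V|$. -/
theorem mul_sub_le_starPotential [Nonempty E] (hI : ∀ x, (I x).Nonempty) {δ : ℝ} (hδ : 0 ≤ δ)
    (h : ∀ F : Finset E, F.Nonempty → F ≠ Finset.univ →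
      meanLoad V E * F.card + δ ≤ (Finset.univ.filter fun x => ∃ e ∈ F, e ∈ I x).card)
    (s : E → ℝ) (e f : E) : δ * (s e - s f) ≤ starPotential I s := by
  obtain ⟨g, hg⟩ := Finite.exists_min s
  have hlog : ∀ x, ∀ e ∈ I x, s e ≤ Real.log (starMass I s x) := fun x e he =>
    (Real.le_log_iff_exp_le (starMass_pos ⟨e, he⟩ s)).2 (exp_le_starMass he s)
  have key := mul_le_sum_sub_of_gap hδ h (fun e => s e - s g)
    (fun x => Real.log (starMass I s x) - s g) (fun e => sub_nonneg.2 (hg e)) ⟨g, sub_self _⟩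
    (fun x => by
      obtain ⟨e, he⟩ := hI x
      linarith [hlog x e he, hg e])
    (fun x e he => sub_le_sub_right (hlog x e he) _) e
  have h1 := mul_le_mul_of_nonneg_left (hg f) hδ
  have h2 := congrArg (· * s g) (meanLoad_mul_card (V := V) (E := E))
  simp only [Finset.sum_sub_distrib, Finset.sum_const, Finset.card_univ, nsmul_eq_mul] at key h2
  rw [starPotential]
  linarith

theorem continuous_starPotential (hI : ∀ x, (I x).Nonempty) : Continuous (starPotential I) := by
  unfold starPotential
  refine Continuous.sub (continuous_finsetSum _ fun x _ => Continuous.log ?_ fun s =>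
    (starMass_pos (hI x) s).ne') (by fun_prop)
  unfold starMass
  fun_prop

theorem starPotential_add_const [Nonempty E] (hI : ∀ x, (I x).Nonempty) (s : E → ℝ) (c : ℝ) :
    starPotential I (fun e => s e + c) = starPotential I s := by
  have hm : ∀ x, Real.log (starMass I (fun f => s f + c) x) = Real.log (starMass I s x) + c :=
    fun x => by
      have : starMass I (fun f => s f + c) x = starMass I s x * Real.exp c := by
        simp only [starMass, Finset.sum_mul, Real.exp_add]
      rw [this, Real.log_mul (starMass_pos (hI x) s).ne' (Real.exp_pos c).ne', Real.log_exp]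
  have h2 := congrArg (· * c) (meanLoad_mul_card (V := V) (E := E))
  simp only [starPotential, hm, Finset.sum_add_distrib, Finset.sum_const, Finset.card_univ,
    nsmul_eq_mul] at h2 ⊢
  linarith

theorem hasDerivAt_starPotential (hI : ∀ x, (I x).Nonempty) (s : E → ℝ) (e : E) :
    HasDerivAt (fun t : ℝ => starPotential I (fun f => s f + if f = e then t else 0))
      (load I s e - meanLoad V E) 0 := by
  have hlin : ∀ f, HasDerivAt (fun t : ℝ => s f + if f = e then t else 0)
      (if f = e then 1 else 0) 0 := fun f => by
    split_ifs
    · exact (hasDerivAt_id _).const_add _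
    · simpa using hasDerivAt_const (0 : ℝ) (s f)
  have hz : (fun f => s f + if f = e then (0 : ℝ) else 0) = s := by simp
  have hmass : ∀ x, HasDerivAt
      (fun t : ℝ => starMass I (fun f => s f + if f = e then t else 0) x)
      (if e ∈ I x then Real.exp (s e) else 0) 0 := fun x => by
    have := HasDerivAt.fun_sum (u := I x) fun f _ => (hlin f).exp
    refine this.congr_deriv ?_
    simp only [mul_ite, mul_one, mul_zero, Finset.sum_ite_eq', ite_self, add_zero]
  have hlog : ∀ x, HasDerivAt
      (fun t : ℝ => Real.log (starMass I (fun f => s f + if f = e then t else 0) x))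
      (starProb I s x e) 0 := fun x => by
    refine ((hmass x).log (starMass_pos (hI x) _).ne').congr_deriv ?_
    rw [hz, starProb]
    split_ifs <;> simp
  have hsum := HasDerivAt.fun_sum (u := Finset.univ) fun x (_ : x ∈ Finset.univ) => hlog x
  have hsum' := HasDerivAt.fun_sum (u := Finset.univ) fun f (_ : f ∈ Finset.univ) => hlin f
  refine (hsum.sub (hsum'.const_mul (meanLoad V E))).congr_deriv ?_
  simp [load]

/-- Under the density condition some weight has constant load. -/
theorem EdgeDensityCondition.exists_load_eq [Nonempty E] (h : EdgeDensityCondition I)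
    (hI : ∀ x, (I x).Nonempty) :
    ∃ u : E → ℝ, ∑ e, u e = 0 ∧ ∀ e, load I u e = meanLoad V E := by
  obtain ⟨δ, hδ, hgap⟩ := h.exists_gap
  have hbd := mul_sub_le_starPotential hI hδ.le hgap
  let K : Set (E → ℝ) := {s | ∑ e, s e = 0 ∧ starPotential I s ≤ starPotential I 0}
  have hK : IsCompact K := by
    refine Metric.isCompact_of_isClosed_isBounded ?_ ?_
    · exact (isClosed_eq (by fun_prop) continuous_const).inter
        (isClosed_le (continuous_starPotential hI) continuous_const)
    · refine (Metric.isBounded_closedBall (x := (0 : E → ℝ))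
        (r := starPotential I 0 / δ)).subset fun s hs => ?_
      have hd : ∀ e f, s e - s f ≤ starPotential I 0 / δ := fun e f => by
        rw [le_div_iff₀ hδ, mul_comm]
        exact (hbd s e f).trans hs.2
      have h0 : 0 ≤ starPotential I 0 / δ := by
        have e := Classical.arbitrary E
        simpa using hd e e
      rw [mem_closedBall_zero_iff, pi_norm_le_iff_of_nonneg h0]
      intro e
      -- Mean zero provides a coordinate `≤ 0` and one `≥ 0`, so the oscillation bounds the norm.
      obtain ⟨f, -, hf⟩ := Finset.exists_le_of_sum_le (s := Finset.univ) (f := s)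
        (g := fun _ => (0 : ℝ)) Finset.univ_nonempty (by simp [hs.1])
      obtain ⟨f', -, hf'⟩ := Finset.exists_le_of_sum_le (s := Finset.univ) (g := s)
        (f := fun _ => (0 : ℝ)) Finset.univ_nonempty (by simp [hs.1])
      rw [Real.norm_eq_abs, abs_le]
      constructor
      · linarith [hd f' e]
      · linarith [hd e f]
  obtain ⟨u, huK, hu⟩ := hK.exists_isMinOn ⟨0, by simp [K]⟩
    (continuous_starPotential hI).continuousOn
  -- Translation to mean zero does not change the potential, so the minimum over `K` is global.
  -- Single coordinates can then be varied freely, although this leaves the hyperplane.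
  have hmin : ∀ s, starPotential I u ≤ starPotential I s := fun s => by
    rw [← starPotential_add_const hI s (-(∑ e, s e) / Fintype.card E)]
    set s' := fun e => s e + -(∑ e, s e) / Fintype.card E
    by_cases hs' : starPotential I s' ≤ starPotential I 0
    · refine hu ⟨?_, hs'⟩
      have : (Fintype.card E : ℝ) ≠ 0 := Nat.cast_ne_zero.2 Fintype.card_ne_zero
      simp only [s', Finset.sum_add_distrib, Finset.sum_const, Finset.card_univ, nsmul_eq_mul]
      field_simp
      ring
    · exact huK.2.trans (le_of_not_ge hs')
  refine ⟨u, huK.1, fun e => sub_eq_zero.1 ?_⟩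
  refine IsLocalMin.hasDerivAt_eq_zero ?_ (hasDerivAt_starPotential hI u e)
  refine Filter.Eventually.of_forall fun t => ?_
  have hz : (fun f => u f + if f = e then (0 : ℝ) else 0) = u := by simp
  simp only [hz]
  exact hmin _

end StarLoad
end LinLuYau

namespace LinLuYau

/-! ### Global solutions of bounded Lipschitz vector fields -/

/-- Speed at most `L` keeps a solution within distance `L * (n + 1)` up to time `n + 1`, so
Picard–Lindelöf works on every bounded interval; uniqueness glues the pieces. -/
theorem exists_forall_hasDerivAt_of_lipschitz_bounded {X : Type*} [NormedAddCommGroup X]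
    [NormedSpace ℝ X] [CompleteSpace X] {F : X → X} {K L : NNReal} (hF : LipschitzWith K F)
    (hL : ∀ x, ‖F x‖ ≤ L) (x₀ : X) :
    ∃ γ : ℝ → X, γ 0 = x₀ ∧ ∀ t, HasDerivAt γ (F (γ t)) t := by
  have hloc : ∀ n : ℕ, ∃ γ : ℝ → X, γ 0 = x₀ ∧
      ∀ t ∈ Set.Ioo (-(n + 1 : ℝ)) (n + 1), HasDerivAt γ (F (γ t)) t := fun n => by
    have hP : IsPicardLindelof (fun _ => F) (tmin := -(n + 1 : ℝ)) (tmax := n + 1)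
        ⟨0, by constructor <;> linarith [n.cast_nonneg (α := ℝ)]⟩ x₀ (L * (n + 1)) 0 L K := by
      refine IsPicardLindelof.of_time_independent (fun x _ => hL x) hF.lipschitzOnWith ?_
      simp
    obtain ⟨γ, h0, hγ⟩ := hP.exists_eq_forall_mem_Icc_hasDerivWithinAt₀
    exact ⟨γ, h0, fun t ht => (hγ t (Set.Ioo_subset_Icc_self ht)).hasDerivAt
      (Icc_mem_nhds ht.1 ht.2)⟩
  choose γ h0 hγ using hloc
  have hagree : ∀ m n : ℕ, m ≤ n → ∀ t ∈ Set.Ioo (-(m + 1 : ℝ)) (m + 1), γ m t = γ n t := by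
    intro m n hmn
    have hmn' : (m : ℝ) ≤ n := by exact_mod_cast hmn
    refine ODE_solution_unique_of_mem_Ioo (v := fun _ => F) (s := fun _ => Set.univ) (K := K)
      (t₀ := 0) (fun _ _ => hF.lipschitzOnWith)
      (by constructor <;> linarith [m.cast_nonneg (α := ℝ)]) (fun t ht => ⟨hγ m t ht, trivial⟩)
      (fun t ht => ⟨hγ n t ⟨?_, ?_⟩, trivial⟩) (by rw [h0, h0])
    · linarith [ht.1]
    · linarith [ht.2]
  refine ⟨fun t => γ ⌈|t|⌉₊ t, by simp [h0], fun t => ?_⟩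
  -- The extra one makes `(-n, n)` a neighbourhood of `t` in which every index used is at most `n`.
  set n := ⌈|t|⌉₊ + 1
  have hmem : ∀ s : ℝ, s ∈ Set.Ioo (-((⌈|s|⌉₊ : ℝ) + 1)) (⌈|s|⌉₊ + 1) := fun s => by
    have := Nat.le_ceil |s|
    have := abs_le.1 this
    constructor <;> linarith
  have ht : t ∈ Set.Ioo (-(n : ℝ)) n := by simpa [n] using hmem t
  have hev : (fun s => γ ⌈|s|⌉₊ s) =ᶠ[𝓝 t] γ n := by
    filter_upwards [Ioo_mem_nhds ht.1 ht.2] with s hs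
    refine hagree _ _ (Nat.ceil_le.2 (abs_le.2 ⟨hs.1.le, hs.2.le⟩)) s (hmem s)
  have := (hγ n t ⟨by linarith [ht.1], by linarith [ht.2]⟩).congr_of_eventuallyEq hev
  rwa [← hev.eq_of_nhds] at this

theorem antitoneOn_Ici_of_hasDerivAt {f f' : ℝ → ℝ} (hf : ContinuousOn f (Set.Ici 0))
    (h : ∀ t, 0 < t → HasDerivAt f (f' t) t) (h' : ∀ t, 0 < t → f' t ≤ 0) :
    AntitoneOn f (Set.Ici 0) := by
  refine antitoneOn_of_deriv_nonpos (convex_Ici 0) hf ?_ ?_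
  · rw [interior_Ici]
    exact fun t ht => (h t ht).differentiableAt.differentiableWithinAt
  · rw [interior_Ici]
    intro t ht
    rw [(h t ht).deriv]
    exact h' t ht

/-! ### The load flow and its convergence -/

section StarLoad

variable {V E : Type*} [Fintype V] [Fintype E] [DecidableEq E] {I : V → Finset E}

variable (I) in
/-- The flow driving the load to its mean, in logarithmic coordinates normalized to have mean
zero. -/
structure IsLoadFlow (u : ℝ → E → ℝ) : Prop where
  cont : ∀ e, ContinuousOn (fun t => u t e) (Set.Ici 0)
  deriv : ∀ t, 0 < t → ∀ e,
    HasDerivAt (fun s => u s e) (-2 * (load I (u t) e - meanLoad V E)) t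
  sum_eq_zero : ∀ t, ∑ e, u t e = 0

variable (I) in
-- Loads lie between 0 and $|V|$ and are Lipschitz in `s`, so the field is bounded and globally
-- Lipschitz.
theorem exists_logFlow (s₀ : E → ℝ) :
    ∃ s : ℝ → E → ℝ, s 0 = s₀ ∧ ∀ t e,
      HasDerivAt (fun s' => s s' e) (-2 * (load I (s t) e - meanLoad V E)) t := by
  have hm : 0 ≤ meanLoad V E := by unfold meanLoad; positivity
  let F : (E → ℝ) → E → ℝ := fun s e => -2 * (load I s e - meanLoad V E)
  have hlip : LipschitzWith (4 * Fintype.card V) F := by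
    refine LipschitzWith.of_dist_le_mul fun s t => ?_
    refine (dist_pi_le_iff (by positivity)).2 fun e => ?_
    have := abs_load_sub_le (I := I) s t e
    rw [Real.dist_eq, dist_eq_norm]
    have h : F s e - F t e = -2 * (load I s e - load I t e) := by simp only [F]; ring
    rw [h, abs_mul]
    norm_num
    linarith
  have hbd : ∀ s, ‖F s‖ ≤ (2 * (Fintype.card V + ⟨meanLoad V E, hm⟩) : NNReal) := fun s => by
    refine (pi_norm_le_iff_of_nonneg NNReal.zero_le_coe).2 fun e => ?_
    have h1 := load_nonneg (I := I) s e
    have h2 := load_le_card (I := I) s e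
    have h3 : ((2 * (Fintype.card V + ⟨meanLoad V E, hm⟩) : NNReal) : ℝ) =
      2 * (Fintype.card V + meanLoad V E) := by push_cast; rfl
    rw [h3, Real.norm_eq_abs, abs_le]
    constructor <;> simp only [F] <;> linarith
  obtain ⟨γ, h0, hγ⟩ := exists_forall_hasDerivAt_of_lipschitz_bounded hlip hbd s₀
  exact ⟨γ, h0, fun t e => hasDerivAt_pi.1 (hγ t) e⟩

theorem sum_load_sub_meanLoad [Nonempty E] (hI : ∀ x, (I x).Nonempty) (s : E → ℝ) :
    ∑ e, (load I s e - meanLoad V E) = 0 := by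
  rw [Finset.sum_sub_distrib, sum_load hI]
  simp only [Finset.sum_const, Finset.card_univ, nsmul_eq_mul]
  linarith [meanLoad_mul_card (V := V) (E := E)]

/-- Subtract the mean. -/
noncomputable def centered (s : E → ℝ) (e : E) : ℝ := s e + -((∑ f, s f) / Fintype.card E)

theorem sum_centered [Nonempty E] (s : E → ℝ) : ∑ e, centered s e = 0 := by
  have : (Fintype.card E : ℝ) ≠ 0 := Nat.cast_ne_zero.2 Fintype.card_ne_zero
  simp only [centered, Finset.sum_add_distrib, Finset.sum_const, Finset.card_univ, nsmul_eq_mul]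
  field_simp
  ring

theorem load_centered (s : E → ℝ) (e : E) : load I (centered s) e = load I s e :=
  load_add_const s _ e

/-- Any common drift disappears after centering. -/
theorem IsLoadFlow.of_drift [Nonempty E] (hI : ∀ x, (I x).Nonempty) {s : ℝ → E → ℝ} {μ : ℝ → ℝ}
    (hc : ∀ e, ContinuousOn (fun t => s t e) (Set.Ici 0))
    (hd : ∀ t, 0 < t → ∀ e,
      HasDerivAt (fun t => s t e) (-2 * (load I (s t) e - meanLoad V E) + μ t) t) :
    IsLoadFlow I fun t => centered (s t) where
  cont e := (hc e).add ((continuousOn_finsetSum _ fun f _ => hc f).div_const _).neg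
  deriv t ht e := by
    have h := (hd t ht e).add ((HasDerivAt.fun_sum (u := Finset.univ)
      fun f (_ : f ∈ Finset.univ) => hd t ht f).div_const (Fintype.card E : ℝ)).neg
    refine h.congr_deriv ?_
    have : (Fintype.card E : ℝ) ≠ 0 := Nat.cast_ne_zero.2 Fintype.card_ne_zero
    rw [Finset.sum_add_distrib, ← Finset.mul_sum, sum_load_sub_meanLoad hI, load_centered]
    simp only [Finset.sum_const, Finset.card_univ, nsmul_eq_mul]
    field_simp
    ring
  sum_eq_zero t := sum_centered _

/-- The squared distance `D` to the balanced point satisfies `D' = -4 W` with `W ≥ 0`, so the orbit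
stays in the ball of radius `√(D 0)`. There the monotonicity constant `k` is fixed, and the Poincaré
constant `P` gives `2 W ≥ (2 k / P) D`, hence `D' ≤ -2 c D`. -/
theorem IsLoadFlow.exists_abs_sub_le_exp [Nonempty E] {u : ℝ → E → ℝ} (hu : IsLoadFlow I u)
    (hI : ∀ x, (I x).Nonempty)
    (hconn : ∀ e f, Relation.ReflTransGen (fun e f => ∃ x, e ∈ I x ∧ f ∈ I x) e f)
    {a : E → ℝ} (ha : ∑ e, a e = 0) (hload : ∀ e, load I a e = meanLoad V E) :
    ∃ C c : ℝ, 0 < c ∧ ∀ t, 0 ≤ t → ∀ e, |u t e - a e| ≤ C * Real.exp (-(c * t)) := by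
  let D : ℝ → ℝ := fun t => ∑ e, (u t e - a e) ^ 2
  let W : ℝ → ℝ := fun t => ∑ e, (u t e - a e) * (load I (u t) e - load I a e)
  have hDc : ContinuousOn D (Set.Ici 0) :=
    continuousOn_finsetSum _ fun e _ => ((hu.cont e).sub continuousOn_const).pow 2
  have hDd : ∀ t, 0 < t → HasDerivAt D (-4 * W t) t := fun t ht => by
    have h := HasDerivAt.fun_sum (u := Finset.univ)
      fun e (_ : e ∈ Finset.univ) => ((hu.deriv t ht e).sub_const (a e)).pow 2
    refine h.congr_deriv ?_
    simp only [W, Finset.mul_sum, hload]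
    refine Finset.sum_congr rfl fun e _ => ?_
    norm_num
    ring
  have hW : ∀ t R, (∀ e, |u t e - a e| ≤ R) →
      Real.exp (-R) * Real.exp (-R) / 2 * starForm I a (u t - a) ≤ W t := fun t R h => by
    have := starForm_le_sum_load_sub hI a (u t - a) h
    rwa [add_sub_cancel] at this
  have hle : ∀ t e, |u t e - a e| ≤ √(D t) := fun t e => by
    refine Real.abs_le_sqrt ?_
    exact Finset.single_le_sum (f := fun e => (u t e - a e) ^ 2) (fun _ _ => sq_nonneg _)
      (Finset.mem_univ e)
  have hanti : AntitoneOn D (Set.Ici 0) := by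
    refine antitoneOn_Ici_of_hasDerivAt hDc hDd fun t _ => ?_
    have h1 := hW t _ (hle t)
    have h2 := starForm_nonneg (I := I) a (u t - a)
    have : 0 ≤ W t := le_trans (by positivity) h1
    linarith
  obtain ⟨P, hP, hpoin⟩ := exists_sum_sq_le_starForm hconn a
  set R := √(D 0)
  set k := Real.exp (-R) * Real.exp (-R) / 2 with hk
  have hk0 : 0 < k := by positivity
  let c := 2 * k / P
  have hc : 0 < c := by positivity
  have hdecay : ∀ t, 0 ≤ t → c * D t ≤ 2 * W t := fun t ht => by
    have hR : ∀ e, |u t e - a e| ≤ R := fun e =>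
      (hle t e).trans (Real.sqrt_le_sqrt (hanti Set.self_mem_Ici ht ht))
    have h1 := hW t R hR
    have h2 : D t ≤ P * starForm I a (u t - a) :=
      hpoin (u t - a) (by simp [hu.sum_eq_zero, ha])
    have h3 : c * D t ≤ c * (P * starForm I a (u t - a)) := mul_le_mul_of_nonneg_left h2 hc.le
    have h4 : c * (P * starForm I a (u t - a)) = 2 * (k * starForm I a (u t - a)) := by
      simp only [c]
      field_simp
    rw [← hk] at h1
    linarith
  have hanti2 : AntitoneOn (fun t => D t * Real.exp (2 * c * t)) (Set.Ici 0) := by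
    refine antitoneOn_Ici_of_hasDerivAt (f' := fun t => (-4 * W t + 2 * c * D t) *
      Real.exp (2 * c * t)) (hDc.mul (by fun_prop)) (fun t ht => ?_) fun t ht => ?_
    · have h := (hDd t ht).mul ((hasDerivAt_id t).const_mul (2 * c)).exp
      refine h.congr_deriv ?_
      simp only [id, mul_one]
      ring
    · have := hdecay t ht.le
      exact mul_nonpos_of_nonpos_of_nonneg (by linarith) (Real.exp_pos _).le
  refine ⟨R, c, hc, fun t ht e => (hle t e).trans ?_⟩
  have h1 : D t * Real.exp (2 * c * t) ≤ D 0 := by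
    simpa using hanti2 Set.self_mem_Ici ht ht
  refine Real.sqrt_le_iff.2 ⟨by positivity, ?_⟩
  have hD0 : 0 ≤ D 0 := Finset.sum_nonneg fun _ _ => sq_nonneg _
  rw [mul_pow, Real.sq_sqrt hD0, ← Real.exp_nat_mul]
  have h2 : Real.exp (((2 : ℕ) : ℝ) * -(c * t)) = (Real.exp (2 * c * t))⁻¹ := by
    rw [← Real.exp_neg]; congr 1; push_cast; ring
  rw [h2, ← div_eq_mul_inv, le_div_iff₀ (Real.exp_pos _)]
  exact h1

/-- A function with exponentially decaying derivative converges. -/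
theorem exists_tendsto_of_abs_deriv_le_exp {f f' : ℝ → ℝ} {C c : ℝ} (hc : 0 < c)
    (hf : ContinuousOn f (Set.Ici 0)) (h : ∀ t, 0 < t → HasDerivAt f (f' t) t)
    (h' : ∀ t, 0 < t → |f' t| ≤ C * Real.exp (-(c * t))) :
    ∃ l, Tendsto (fun n : ℕ => f n) atTop (𝓝 l) := by
  -- `g` is the integral over `[t, ∞)` of the bound on the derivative, so `f + g` and `g - f` are
  -- both decreasing.
  let g : ℝ → ℝ := fun t => C / c * Real.exp (-(c * t))
  have hg : ∀ t, HasDerivAt g (-(C * Real.exp (-(c * t)))) t := fun t => by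
    refine ((((hasDerivAt_id t).const_mul c).neg.exp).const_mul (C / c)).congr_deriv ?_
    simp only [id, Pi.neg_apply]
    field_simp
  have hgc : Continuous g := by fun_prop
  have h1 : AntitoneOn (fun t => f t + g t) (Set.Ici 0) :=
    antitoneOn_Ici_of_hasDerivAt (hf.add hgc.continuousOn) (fun t ht => (h t ht).add (hg t))
      fun t ht => by linarith [(abs_le.1 (h' t ht)).2]
  have h2 : AntitoneOn (fun t => g t - f t) (Set.Ici 0) :=
    antitoneOn_Ici_of_hasDerivAt (hgc.continuousOn.sub hf) (fun t ht => (hg t).sub (h t ht))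
      fun t ht => by linarith [(abs_le.1 (h' t ht)).1]
  have hnn : ∀ n : ℕ, (n : ℝ) ∈ Set.Ici (0 : ℝ) := fun n => Set.mem_Ici.2 n.cast_nonneg
  have hg0 : Tendsto (fun n : ℕ => g n) atTop (𝓝 0) := by
    have : Tendsto (fun n : ℕ => Real.exp (-(c * (n : ℝ)))) atTop (𝓝 0) :=
      Real.tendsto_exp_neg_atTop_nhds_zero.comp
        (tendsto_natCast_atTop_atTop.const_mul_atTop hc)
    simpa using this.const_mul (C / c)
  have hC : 0 ≤ C := by
    by_contra hC
    have := (abs_nonneg _).trans (h' 1 one_pos)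
    nlinarith [Real.exp_pos (-(c * 1))]
  have hgn : ∀ t, 0 ≤ g t := fun t => by positivity
  have ha : Antitone fun n : ℕ => f n + g n := fun m n hmn =>
    h1 (hnn m) (hnn n) (by exact_mod_cast hmn)
  have hb : BddBelow (Set.range fun n : ℕ => f n + g n) := by
    refine ⟨f 0 - g 0, ?_⟩
    rintro _ ⟨n, rfl⟩
    have := h2 Set.self_mem_Ici (hnn n) (hnn n)
    simp only at this ⊢
    linarith [hgn n]
  exact ⟨_, by simpa using (tendsto_atTop_ciInf ha hb).sub hg0⟩

/-- The load deviation is the velocity up to the factor −2. Its exponential decay makes the orbit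
converge, and by continuity the limit is balanced. -/
theorem IsLoadFlow.exists_load_eq {u : ℝ → E → ℝ} (hu : IsLoadFlow I u) {C c : ℝ} (hc : 0 < c)
    (h : ∀ t, 0 ≤ t → ∀ e, |load I (u t) e - meanLoad V E| ≤ C * Real.exp (-(c * t))) :
    ∃ a : E → ℝ, ∀ e, load I a e = meanLoad V E := by
  have hlim : ∀ e, ∃ l, Tendsto (fun n : ℕ => u n e) atTop (𝓝 l) := fun e =>
    exists_tendsto_of_abs_deriv_le_exp (C := 2 * C) hc (hu.cont e)
      (fun t ht => hu.deriv t ht e) fun t ht => by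
        have := h t ht.le e
        rw [abs_mul, abs_neg, abs_two]
        linarith
  choose a ha using hlim
  refine ⟨a, fun e => ?_⟩
  have h1 : Tendsto (fun n : ℕ => load I (u n) e) atTop (𝓝 (load I a e)) :=
    ((continuous_load e).tendsto a).comp (tendsto_pi_nhds.2 ha)
  refine tendsto_nhds_unique h1 ?_
  rw [tendsto_iff_norm_sub_tendsto_zero]
  have h0 : Tendsto (fun n : ℕ => C * Real.exp (-(c * (n : ℝ)))) atTop (𝓝 0) := by
    have : Tendsto (fun n : ℕ => Real.exp (-(c * (n : ℝ)))) atTop (𝓝 0) :=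
      Real.tendsto_exp_neg_atTop_nhds_zero.comp
        (tendsto_natCast_atTop_atTop.const_mul_atTop hc)
    simpa using this.const_mul C
  exact squeeze_zero (fun _ => norm_nonneg _) (fun n => h n n.cast_nonneg e) h0

end StarLoad
end LinLuYau

namespace LinLuYau

/-! ### Duality for optimal transport -/

section Transport

variable {V : Type*} [Fintype V]

theorem IsTransportPlan.left_ne_zero {μ ν : V → ℝ} {A : V → V → ℝ} (hA : IsTransportPlan μ ν A)
    {u v : V} (h : A u v ≠ 0) : μ u ≠ 0 := by
  rw [← hA.2.1 u]
  exact (Finset.sum_pos' (fun v _ => (hA.1 u v).1)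
    ⟨v, Finset.mem_univ v, lt_of_le_of_ne (hA.1 u v).1 h.symm⟩).ne'

theorem IsTransportPlan.right_ne_zero {μ ν : V → ℝ} {A : V → V → ℝ} (hA : IsTransportPlan μ ν A)
    {u v : V} (h : A u v ≠ 0) : ν v ≠ 0 := by
  rw [← hA.2.2 v]
  exact (Finset.sum_pos' (fun u _ => (hA.1 u v).1)
    ⟨u, Finset.mem_univ u, lt_of_le_of_ne (hA.1 u v).1 h.symm⟩).ne'

theorem IsTransportPlan.sum_potential {μ ν : V → ℝ} {A : V → V → ℝ} (hA : IsTransportPlan μ ν A)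
    (f g : V → ℝ) :
    ∑ u, ∑ v, (f u - g v) * A u v = ∑ u, f u * μ u - ∑ v, g v * ν v := by
  simp only [sub_mul, Finset.sum_sub_distrib]
  congr 1
  · simp only [← Finset.mul_sum, hA.2.1]
  · rw [Finset.sum_comm]
    simp only [← Finset.mul_sum, hA.2.2]

/-- Kantorovich duality: a pair of potentials that is admissible on the supports and tight on
some plan computes the Wasserstein distance. -/
theorem wasserstein_eq_of_potential (G : SimpleGraph V) {μ ν : V → ℝ} {A : V → V → ℝ}
    (hA : IsTransportPlan μ ν A) (f g : V → ℝ)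
    (hle : ∀ u v, μ u ≠ 0 → ν v ≠ 0 → f u - g v ≤ G.dist u v)
    (hge : ∀ u v, A u v ≠ 0 → (G.dist u v : ℝ) ≤ f u - g v) :
    wasserstein G μ ν = ∑ u, f u * μ u - ∑ v, g v * ν v := by
  refine IsLeast.csInf_eq ⟨⟨A, hA, ?_⟩, ?_⟩
  · rw [← hA.sum_potential f g]
    refine Finset.sum_congr rfl fun u _ => Finset.sum_congr rfl fun v _ => ?_
    by_cases h : A u v = 0
    · simp [h]
    · rw [le_antisymm (hge u v h) (hle u v (hA.left_ne_zero h) (hA.right_ne_zero h))]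
  · rintro c ⟨B, hB, rfl⟩
    rw [← hB.sum_potential f g]
    refine Finset.sum_le_sum fun u _ => Finset.sum_le_sum fun v _ => ?_
    by_cases h : B u v = 0
    · simp [h]
    · exact mul_le_mul_of_nonneg_right (hle u v (hB.left_ne_zero h) (hB.right_ne_zero h))
        (hB.1 u v).1

end Transport

/-! ### Distances in graphs without short cycles -/

section Girth

variable {V : Type*} {G : SimpleGraph V}

theorem not_adj_of_adj_of_adj (hg : 6 ≤ G.egirth) {a b c : V} (hab : G.Adj a b)
    (hbc : G.Adj b c) : ¬ G.Adj c a := fun hca => by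
  have h := SimpleGraph.le_egirth.1 hg a (.cons hab (.cons hbc (.cons hca .nil))) (by
    rw [SimpleGraph.Walk.cons_isCycle_iff]
    have := hab.ne
    have := hbc.ne
    have := hca.ne
    simp [SimpleGraph.Walk.isPath_def]
    grind)
  simp at h
  exact absurd h (by decide)

theorem not_adj_of_square (hg : 6 ≤ G.egirth) {a b c d : V} (hab : G.Adj a b)
    (hbc : G.Adj b c) (hcd : G.Adj c d) (hac : a ≠ c) (hbd : b ≠ d) : ¬ G.Adj d a := fun hda => by
  have h := SimpleGraph.le_egirth.1 hg a (.cons hab (.cons hbc (.cons hcd (.cons hda .nil)))) (by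
    rw [SimpleGraph.Walk.cons_isCycle_iff]
    have := hab.ne
    have := hbc.ne
    have := hcd.ne
    have := hda.ne
    simp [SimpleGraph.Walk.isPath_def]
    grind)
  simp at h
  exact absurd h (by decide)

theorem not_adj_of_pentagon (hg : 6 ≤ G.egirth) {a b c d e : V} (hab : G.Adj a b)
    (hbc : G.Adj b c) (hcd : G.Adj c d) (hde : G.Adj d e) (hac : a ≠ c) (had : a ≠ d)
    (hbd : b ≠ d) (hbe : b ≠ e) (hce : c ≠ e) : ¬ G.Adj e a := fun hea => by
  have h := SimpleGraph.le_egirth.1 hg a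
    (.cons hab (.cons hbc (.cons hcd (.cons hde (.cons hea .nil))))) (by
    rw [SimpleGraph.Walk.cons_isCycle_iff]
    have := hab.ne
    have := hbc.ne
    have := hcd.ne
    have := hde.ne
    have := hea.ne
    simp [SimpleGraph.Walk.isPath_def]
    grind)
  simp at h
  exact absurd h (by decide)

theorem two_le_dist_of_adj_of_adj (hc : G.Connected) (hg : 6 ≤ G.egirth) {a b c : V}
    (hab : G.Adj a b) (hbc : G.Adj b c) (hac : a ≠ c) : 2 ≤ G.dist a c := by
  have h0 := hc.pos_dist_of_ne hac
  have h1 : G.dist a c ≠ 1 := fun h =>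
    not_adj_of_adj_of_adj hg hab hbc (SimpleGraph.dist_eq_one_iff_adj.1 h).symm
  omega

/-- Distance 0, 1 or 2 between the ends would close the path to a triangle, a square or a pentagon.
-/
theorem three_le_dist_of_path (hc : G.Connected) (hg : 6 ≤ G.egirth) {u x y v : V}
    (hux : G.Adj u x) (hxy : G.Adj x y) (hyv : G.Adj y v) (huy : u ≠ y) (hxv : x ≠ v) :
    3 ≤ G.dist u v := by
  have huv : u ≠ v := fun h => by
    subst h
    exact not_adj_of_adj_of_adj hg hux hxy hyv
  have h0 := hc.pos_dist_of_ne huv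
  have h1 : G.dist u v ≠ 1 := fun h =>
    not_adj_of_square hg hux hxy hyv huy hxv (SimpleGraph.dist_eq_one_iff_adj.1 h).symm
  have h2 : G.dist u v ≠ 2 := fun h => by
    obtain ⟨p, hp⟩ := hc.exists_walk_length_eq_dist u v
    rw [h] at hp
    match p, hp with
    | .cons (v := w) huw (.cons hwv .nil), _ =>
      -- If the midpoint `w` is `x` or `y`, the pentagon degenerates and a triangle appears instead.
      refine not_adj_of_pentagon hg hux hxy hyv hwv.symm huy huv hxv ?_ ?_ huw.symm
      · rintro rfl
        exact not_adj_of_adj_of_adj hg hxy hyv hwv.symm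
      · rintro rfl
        exact not_adj_of_adj_of_adj hg hux hxy huw.symm
  omega

end Girth

/-! ### The explicit curvature formula -/

section Curvature

variable {V : Type*} [Fintype V] [DecidableEq V] (G : SimpleGraph V) [DecidableRel G.Adj]

theorem wt_eq_zero {ω : G.edgeSet → ℝ} {x y : V} (h : ¬ G.Adj x y) : wt G ω x y = 0 :=
  dif_neg h

theorem wt_nonneg {ω : G.edgeSet → ℝ} (hω : ∀ e, 0 < ω e) (x y : V) : 0 ≤ wt G ω x y := by
  unfold wt
  split_ifs
  · exact (hω _).le
  · exact le_rfl

theorem wt_comm (ω : G.edgeSet → ℝ) (x y : V) : wt G ω x y = wt G ω y x := by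
  simp only [wt, G.adj_comm x y, Sym2.eq_swap (a := x)]

theorem vertexMass_pos {ω : G.edgeSet → ℝ} (hω : ∀ e, 0 < ω e) {x y : V} (h : G.Adj x y) :
    0 < vertexMass G ω x :=
  Finset.sum_pos' (fun z _ => wt_nonneg G hω x z)
    ⟨y, Finset.mem_univ y, by rw [wt, dif_pos h]; exact hω _⟩

theorem lazyMeasure_eq (ω : G.edgeSet → ℝ) (α : ℝ) (x y : V) :
    lazyMeasure G ω α x y =
      (if y = x then α else 0) + (1 - α) * (wt G ω x y / vertexMass G ω x) := by
  unfold lazyMeasure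
  split_ifs with h1 h2
  · simp [h1, wt]
  · simp
  · simp [wt_eq_zero G h2]

theorem sum_lazyMeasure {ω : G.edgeSet → ℝ} (hω : ∀ e, 0 < ω e) (α : ℝ) {x y : V}
    (h : G.Adj x y) : ∑ z, lazyMeasure G ω α x z = 1 := by
  simp only [lazyMeasure_eq, Finset.sum_add_distrib, ← Finset.mul_sum, ← Finset.sum_div]
  rw [← vertexMass, div_self (vertexMass_pos G hω h).ne']
  simp

theorem lazyMeasure_nonneg {ω : G.edgeSet → ℝ} (hω : ∀ e, 0 < ω e) {α : ℝ} (h0 : 0 ≤ α)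
    (h1 : α ≤ 1) (x z : V) : 0 ≤ lazyMeasure G ω α x z := by
  unfold lazyMeasure
  split_ifs
  · exact h0
  · exact mul_nonneg (sub_nonneg.2 h1)
      (div_nonneg (wt_nonneg G hω x z) (Finset.sum_nonneg fun w _ => wt_nonneg G hω x w))
  · exact le_rfl

theorem lazyMeasure_self (ω : G.edgeSet → ℝ) (α : ℝ) (x : V) : lazyMeasure G ω α x x = α :=
  if_pos rfl

theorem eq_or_adj_of_lazyMeasure_ne_zero {ω : G.edgeSet → ℝ} {α : ℝ} {x z : V}
    (h : lazyMeasure G ω α x z ≠ 0) : z = x ∨ G.Adj x z := by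
  unfold lazyMeasure at h
  split_ifs at h with h1 h2
  · exact Or.inl h1
  · exact Or.inr h2
  · exact absurd rfl h

variable {G}

/-- The optimal plan moves the mass outside `x` to `y`, and serves the points outside `y` from the
mass at `x`. -/
theorem isTransportPlan_lazyMeasure {ω : G.edgeSet → ℝ} (hω : ∀ e, 0 < ω e) {α : ℝ}
    (h0 : 1 / 2 ≤ α) (h1 : α ≤ 1) {x y : V} (hxy : G.Adj x y) :
    IsTransportPlan (lazyMeasure G ω α x) (lazyMeasure G ω α y) fun u v =>
      if u = x then (if v = y then 2 * α - 1 else lazyMeasure G ω α y v)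
      else (if v = y then lazyMeasure G ω α x u else 0) := by
  have hn := lazyMeasure_nonneg G hω (by linarith : 0 ≤ α) h1
  have hsx := sum_lazyMeasure G hω α hxy
  have hsy := sum_lazyMeasure G hω α hxy.symm
  have hle : ∀ z w t, G.Adj z t → lazyMeasure G ω α z w ≤ 1 := fun z w t h =>
    (Finset.single_le_sum (fun w _ => hn z w) (Finset.mem_univ w)).trans_eq
      (sum_lazyMeasure G hω α h)
  refine ⟨fun u v => ?_, fun u => ?_, fun v => ?_⟩
  -- The entry `2 * α - 1` is what remains of the mass `α` at `x` after serving the points other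
  -- than `y`, which need `1 - α`; hence the requirement `1 / 2 ≤ α`.
  · dsimp only
    split_ifs
    · constructor <;> linarith
    · exact ⟨hn _ _, hle _ _ _ hxy.symm⟩
    · exact ⟨hn _ _, hle _ _ _ hxy⟩
    · simp
  · by_cases hu : u = x
    · subst hu
      simp only [if_true, lazyMeasure_self]
      rw [← Finset.add_sum_erase _ _ (Finset.mem_univ y)] at hsy ⊢
      rw [lazyMeasure_self] at hsy
      rw [if_pos rfl, Finset.sum_congr rfl fun v hv => if_neg (Finset.ne_of_mem_erase hv)]
      linarith
    · simp [hu]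
  · by_cases hv : v = y
    · subst hv
      simp only [if_true, lazyMeasure_self]
      rw [← Finset.add_sum_erase _ _ (Finset.mem_univ x)] at hsx ⊢
      rw [lazyMeasure_self] at hsx
      rw [if_pos rfl, Finset.sum_congr rfl fun v hv => if_neg (Finset.ne_of_mem_erase hv)]
      linarith
    · simp [hv]

theorem wasserstein_lazyMeasure (hc : G.Connected) (hg : 6 ≤ G.egirth) {ω : G.edgeSet → ℝ}
    (hω : ∀ e, 0 < ω e) {α : ℝ} (h0 : 1 / 2 ≤ α) (h1 : α ≤ 1) {x y : V} (hxy : G.Adj x y) :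
    wasserstein G (lazyMeasure G ω α x) (lazyMeasure G ω α y) =
      1 + 2 * (1 - α) *
        (1 - wt G ω x y / vertexMass G ω x - wt G ω x y / vertexMass G ω y) := by
  have hne := hxy.ne
  have hd1 : ∀ {a b}, G.Adj a b → G.dist a b = 1 := SimpleGraph.dist_eq_one_iff_adj.2
  have hd2 : ∀ {a b c}, G.Adj a b → G.Adj b c → (G.dist a c : ℝ) ≤ 2 := fun hab hbc => by
    exact_mod_cast SimpleGraph.dist_le (.cons hab (.cons hbc .nil))
  have hd2' : ∀ {a b c}, G.Adj a b → G.Adj b c → a ≠ c → (2 : ℝ) ≤ G.dist a c :=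
    fun hab hbc hac => by exact_mod_cast two_le_dist_of_adj_of_adj hc hg hab hbc hac
  -- The potential takes the values 1, 0, −1, −2 along a path `u, x, y, v`. Its version `f` is meant
  -- for `x`, `y` and the other neighbours of `x`, its version `g` for `x`, `y` and the other
  -- neighbours of `y`. Girth at least six makes such a `u` and `v` lie at distance 3, so the pair
  -- is admissible.
  rw [wasserstein_eq_of_potential G (isTransportPlan_lazyMeasure hω h0 h1 hxy)
    (fun z => 1 - (if z = x then 1 else 0) - (if z = y then 2 else 0))
    (fun z => -2 + (if z = x then 2 else 0) + (if z = y then 1 else 0))]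
  · simp only [sub_mul, add_mul, Finset.sum_sub_distrib, Finset.sum_add_distrib, ite_mul, zero_mul,
      Finset.sum_ite_eq', Finset.mem_univ, if_true, ← Finset.mul_sum, one_mul, lazyMeasure_self]
    rw [sum_lazyMeasure G hω α hxy, sum_lazyMeasure G hω α hxy.symm]
    simp only [lazyMeasure_eq, hne, hne.symm, if_false, wt_comm G ω y x]
    ring
  · intro u v hu hv
    rcases eq_or_adj_of_lazyMeasure_ne_zero G hu with rfl | hu
    · rcases eq_or_adj_of_lazyMeasure_ne_zero G hv with rfl | hv
      · simp [hne, hne.symm, hd1 hxy]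
        norm_num
      · by_cases hvu : v = u
        · subst hvu; simp [hne]
        · have := hd2' hxy hv (Ne.symm hvu)
          simpa [hne, hvu, hv.ne.symm] using this
    · rcases eq_or_adj_of_lazyMeasure_ne_zero G hv with rfl | hv
      · by_cases huv : u = v
        · subst huv; simp [hne.symm]
        · have := hd2' hu.symm hxy huv
          simp only [huv, hu.ne.symm, hne.symm, if_true, if_false]
          linarith
      · by_cases huy : u = y <;> by_cases hvx : v = x
        · subst huy hvx
          simp [hne, hne.symm]
          linarith [(Nat.cast_nonneg (G.dist u v) : (0 : ℝ) ≤ _)]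
        · subst huy
          simp only [hne.symm, hvx, hv.ne.symm, if_true, if_false, hd1 hv]
          norm_num
        · subst hvx
          simp only [huy, hne, hu.ne.symm, if_true, if_false, hd1 hu.symm]
          norm_num
        · have : (3 : ℝ) ≤ G.dist u v := by
            exact_mod_cast three_le_dist_of_path hc hg hu.symm hxy hv huy (Ne.symm hvx)
          simp only [huy, hvx, hu.ne.symm, hv.ne.symm, if_false]
          linarith
  · intro u v h
    by_cases hu : u = x <;> by_cases hv : v = y
    · subst hu hv
      simp [hne, hne.symm, hd1 hxy]
      norm_num
    · subst hu
      simp only [if_true, hv, if_false] at h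
      have hyv := (eq_or_adj_of_lazyMeasure_ne_zero G h).resolve_left hv
      by_cases hvu : v = u
      · subst hvu; simp [hne]
      · simpa [hne, hvu, hv] using hd2 hxy hyv
    · subst hv
      simp only [if_true, hu, if_false] at h
      have hxu := (eq_or_adj_of_lazyMeasure_ne_zero G h).resolve_left hu
      by_cases huv : u = v
      · subst huv; simp [hne.symm]
      · have := hd2 hxu.symm hxy
        simp only [huv, hu, hne.symm, if_true, if_false]
        linarith
    · simp [hu, hv] at h

theorem curvature_eq (hc : G.Connected) (hg : 6 ≤ G.egirth) {ω : G.edgeSet → ℝ}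
    (hω : ∀ e, 0 < ω e) {x y : V} (hxy : G.Adj x y) :
    curvature G ω x y =
      2 * (wt G ω x y / vertexMass G ω x + wt G ω x y / vertexMass G ω y - 1) := by
  unfold curvature
  -- The quotient is already constant for `α` in `(1/2, 1)`.
  refine Tendsto.limUnder_eq (tendsto_const_nhds.congr' ?_)
  filter_upwards [Ioo_mem_nhdsLT (by norm_num : (1 / 2 : ℝ) < 1)] with α hα
  rw [wasserstein_lazyMeasure hc hg hω hα.1.le hα.2.le hxy,
    SimpleGraph.dist_eq_one_iff_adj.2 hxy]
  have : 1 - α ≠ 0 := (sub_pos.2 hα.2).ne'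
  field_simp
  ring

end Curvature
end LinLuYau

namespace LinLuYau

/-! ### From the graph to the load map -/

section Edges

variable {V : Type*} [Fintype V] [DecidableEq V] (G : SimpleGraph V) [DecidableRel G.Adj]

/-- The edges at the vertex `x`. -/
def edgesAt (x : V) : Finset G.edgeSet := Finset.univ.filter fun e => x ∈ e.1

theorem mem_edgesAt {x : V} {e : G.edgeSet} : e ∈ edgesAt G x ↔ x ∈ e.1 := by simp [edgesAt]

variable {G}

theorem edgesAt_nonempty [Nontrivial V] (hc : G.Connected) (x : V) : (edgesAt G x).Nonempty := by
  obtain ⟨y, hy⟩ := exists_ne x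
  obtain ⟨p⟩ := hc.preconnected x y
  cases p with
  | nil => exact absurd rfl hy
  | cons h _ => exact ⟨⟨s(x, _), h⟩, (mem_edgesAt G).2 (Sym2.mem_mk_left _ _)⟩

theorem nonempty_edgeSet [Nontrivial V] (hc : G.Connected) : Nonempty G.edgeSet :=
  have ⟨x⟩ := hc.nonempty
  (edgesAt_nonempty hc x).to_type

theorem reflTransGen_edgesAt (hc : G.Connected) (e f : G.edgeSet) :
    Relation.ReflTransGen (fun e f => ∃ x, e ∈ edgesAt G x ∧ f ∈ edgesAt G x) e f := by
  have key : ∀ {x y : V} (_ : G.Walk x y) (e f : G.edgeSet), e ∈ edgesAt G x → f ∈ edgesAt G y →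
      Relation.ReflTransGen (fun e f => ∃ x, e ∈ edgesAt G x ∧ f ∈ edgesAt G x) e f := by
    intro x y p
    induction p with
    | nil => exact fun e f he hf => .single ⟨_, he, hf⟩
    | @cons x z y h p ih =>
      intro e f he hf
      exact .head ⟨x, he, (mem_edgesAt G).2 (Sym2.mem_mk_left _ _)⟩
        (ih ⟨s(x, z), h⟩ f ((mem_edgesAt G).2 (Sym2.mem_mk_right _ _)) hf)
  obtain ⟨p⟩ := hc.preconnected e.1.out.1 f.1.out.1
  exact key p e f ((mem_edgesAt G).2 (Sym2.out_fst_mem _)) ((mem_edgesAt G).2 (Sym2.out_fst_mem _))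

theorem vertexMass_eq_sum_edgesAt (ω : G.edgeSet → ℝ) (x : V) :
    vertexMass G ω x = ∑ e ∈ edgesAt G x, ω e := by
  rw [vertexMass, ← Finset.sum_filter_of_ne (p := fun y => G.Adj x y)
    fun y _ h => by_contra fun h' => h (wt_eq_zero G h')]
  refine Finset.sum_bij (fun y hy => ⟨s(x, y), (Finset.mem_filter.1 hy).2⟩) ?_ ?_ ?_ ?_
  · exact fun y hy => (mem_edgesAt G).2 (Sym2.mem_mk_left _ _)
  · intro y hy z hz h
    exact Sym2.congr_right.1 (Subtype.ext_iff.1 h)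
  · rintro ⟨e, he⟩ hx
    obtain ⟨y, rfl⟩ := (mem_edgesAt G).1 hx
    exact ⟨y, Finset.mem_filter.2 ⟨Finset.mem_univ _, he⟩, rfl⟩
  · intro y hy
    rw [wt, dif_pos (Finset.mem_filter.1 hy).2]

/-- Logarithmic coordinates of a weight. -/
noncomputable def logWeight (ω : G.edgeSet → ℝ) (e : G.edgeSet) : ℝ := Real.log (ω e)

theorem starMass_logWeight {ω : G.edgeSet → ℝ} (hω : ∀ e, 0 < ω e) (x : V) :
    starMass (edgesAt G) (logWeight ω) x = vertexMass G ω x := by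
  rw [vertexMass_eq_sum_edgesAt]
  exact Finset.sum_congr rfl fun e _ => Real.exp_log (hω e)

theorem logWeight_exp (s : G.edgeSet → ℝ) : logWeight (fun e => Real.exp (s e)) = s :=
  funext fun e => Real.log_exp (s e)

/-- Only the stars of the two endpoints contain the edge, so its load consists of the two quotients
in `curvature_eq`. -/
theorem edgeCurvature_eq (hc : G.Connected) (hg : 6 ≤ G.egirth) {ω : G.edgeSet → ℝ}
    (hω : ∀ e, 0 < ω e) (e : G.edgeSet) :
    edgeCurvature G ω e = 2 * (load (edgesAt G) (logWeight ω) e - 1) := by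
  obtain ⟨e, he⟩ := e
  induction e using Sym2.ind with
  | _ x y =>
  have hxy : G.Adj x y := he
  have h1 : edgeCurvature G ω ⟨s(x, y), he⟩ = curvature G ω x y := rfl
  have hz : ∀ z, starProb (edgesAt G) (logWeight ω) z ⟨s(x, y), he⟩ =
      (if z = x then wt G ω x y / vertexMass G ω z else 0) +
        if z = y then wt G ω x y / vertexMass G ω z else 0 := fun z => by
    have hw : wt G ω x y = ω ⟨s(x, y), he⟩ := dif_pos hxy
    rw [starProb, starMass_logWeight hω, logWeight, Real.exp_log (hω _), hw]
    simp only [mem_edgesAt, Sym2.mem_iff]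
    by_cases hzx : z = x
    · subst hzx; simp [hxy.ne]
    · simp [hzx]
  rw [h1, curvature_eq hc hg hω hxy, load]
  simp only [hz, Finset.sum_add_distrib, Finset.sum_ite_eq', Finset.mem_univ, if_true]

theorem avgCurvature_eq : avgCurvature G = 2 * (meanLoad V G.edgeSet - 1) := by
  rw [avgCurvature, meanLoad, SimpleGraph.edgeFinset_card]

theorem sum_edgeCurvature_div_card [Nontrivial V] (hc : G.Connected) (hg : 6 ≤ G.egirth)
    {ω : G.edgeSet → ℝ} (hω : ∀ e, 0 < ω e) :
    (∑ e, edgeCurvature G ω e) / (G.edgeFinset.card : ℝ) = avgCurvature G := by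
  have := nonempty_edgeSet hc
  have hE : (Fintype.card G.edgeSet : ℝ) ≠ 0 := Nat.cast_ne_zero.2 Fintype.card_ne_zero
  simp only [edgeCurvature_eq hc hg hω, ← Finset.mul_sum, Finset.sum_sub_distrib,
    sum_load (edgesAt_nonempty hc), avgCurvature, SimpleGraph.edgeFinset_card]
  simp only [Finset.sum_const, Finset.card_univ, nsmul_eq_mul]
  field_simp

/-! ### The density condition -/

theorem ncard_edgeSet_induce (Ω : Finset V) :
    (G.induce (Ω : Set V)).edgeSet.ncard =
      (Finset.univ.filter fun e : G.edgeSet => ∀ x ∈ e.1, x ∈ Ω).card := by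
  have h : Sym2.map Subtype.val '' (G.induce (Ω : Set V)).edgeSet =
      ((Finset.univ.filter fun e : G.edgeSet => ∀ x ∈ e.1, x ∈ Ω).map
        (Function.Embedding.subtype _) : Finset (Sym2 V)) := by
    ext e
    induction e using Sym2.ind with
    | _ x y =>
    constructor
    · rintro ⟨e, he, hxy⟩
      induction e using Sym2.ind with
      | _ a b =>
      rw [← hxy]
      simpa using he
    · intro h
      simp only [Finset.coe_map, Function.Embedding.subtype_apply, Set.mem_image, Finset.coe_filter,
        Finset.mem_univ, true_and, Set.mem_ofPred_eq, Subtype.exists] at h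
      obtain ⟨e, he, hΩ, rfl⟩ := h
      exact ⟨s(⟨x, hΩ x (Sym2.mem_mk_left _ _)⟩, ⟨y, hΩ y (Sym2.mem_mk_right _ _)⟩), he, rfl⟩
  rw [← Set.ncard_image_of_injective _ (Sym2.map.injective Subtype.val_injective), h,
    Set.ncard_coe_finset, Finset.card_map]

theorem densityCondition_iff [Nontrivial V] (hc : G.Connected) :
    DensityCondition G ↔ ∀ Ω : Finset V, Ω.Nonempty → Ω ≠ Finset.univ →
      meanLoad V G.edgeSet * (Finset.univ.filter fun e : G.edgeSet => ∀ x ∈ e.1, x ∈ Ω).card <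
        Ω.card := by
  have := nonempty_edgeSet hc
  have hE : (0 : ℝ) < Fintype.card G.edgeSet := Nat.cast_pos.2 Fintype.card_pos
  have hV : (0 : ℝ) < Fintype.card V := Nat.cast_pos.2 Fintype.card_pos
  refine forall_congr' fun Ω => forall_congr' fun hΩ => forall_congr' fun _ => ?_
  have hc : (0 : ℝ) < Ω.card := Nat.cast_pos.2 hΩ.card_pos
  rw [ncard_edgeSet_induce, SimpleGraph.edgeFinset_card, div_lt_div_iff₀ hc hV, meanLoad,
    div_mul_eq_mul_div, div_lt_iff₀ hE, mul_comm (Fintype.card V : ℝ),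
    mul_comm (Fintype.card G.edgeSet : ℝ)]

/-- Let `Ω` be the set of vertices touched by `F`; then `F` is contained in $E(\Omega)$. If `Ω` is
all of `V`, strictness comes from `F` being proper, through $\rho|F|<\rho|E|=|V|$. -/
theorem DensityCondition.edgeDensityCondition [Nontrivial V] (hc : G.Connected)
    (h : DensityCondition G) : EdgeDensityCondition (edgesAt G) := by
  rw [densityCondition_iff hc] at h
  have := nonempty_edgeSet hc
  have hρ : 0 < meanLoad V G.edgeSet :=
    div_pos (Nat.cast_pos.2 Fintype.card_pos) (Nat.cast_pos.2 Fintype.card_pos)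
  intro F hF hF'
  set Ω := Finset.univ.filter fun x => ∃ e ∈ F, e ∈ edgesAt G x with hΩ
  by_cases hu : Ω = Finset.univ
  · rw [hu, Finset.card_univ, ← meanLoad_mul_card (V := V) (E := G.edgeSet)]
    refine mul_lt_mul_of_pos_left ?_ hρ
    exact_mod_cast (Finset.card_lt_iff_ne_univ F).2 hF'
  · have hne : Ω.Nonempty := by
      obtain ⟨e, he⟩ := hF
      exact ⟨e.1.out.1, Finset.mem_filter.2 ⟨Finset.mem_univ _, e, he,
        (mem_edgesAt G).2 (Sym2.out_fst_mem _)⟩⟩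
    refine lt_of_le_of_lt (mul_le_mul_of_nonneg_left ?_ hρ.le) (h Ω hne hu)
    refine Nat.cast_le.2 (Finset.card_le_card fun e he => Finset.mem_filter.2
      ⟨Finset.mem_univ _, fun x hx => Finset.mem_filter.2 ⟨Finset.mem_univ _, e, he,
        (mem_edgesAt G).2 hx⟩⟩)

/-- The total load $\rho|E(\Omega)|$ is supplied by the vertices of $\Omega$ alone, each giving at
most one unit. By connectedness some vertex of $\Omega$ has an edge leaving $\Omega$, which takes a
positive share, so the inequality is strict. -/
theorem densityCondition_of_load_eq [Nontrivial V] (hc : G.Connected) {a : G.edgeSet → ℝ}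
    (ha : ∀ e, load (edgesAt G) a e = meanLoad V G.edgeSet) : DensityCondition G := by
  rw [densityCondition_iff hc]
  intro Ω hΩ hΩ'
  set F := Finset.univ.filter fun e : G.edgeSet => ∀ x ∈ e.1, x ∈ Ω with hF
  have h1 : meanLoad V G.edgeSet * F.card = ∑ x, ∑ e ∈ F, starProb (edgesAt G) a x e := by
    rw [Finset.sum_comm, mul_comm, ← nsmul_eq_mul, ← Finset.sum_const]
    exact Finset.sum_congr rfl fun e _ => (ha e).symm
  have h2 : (Ω.card : ℝ) = ∑ x, if x ∈ Ω then 1 else 0 := by simp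
  have hle : ∀ x, ∑ e ∈ F, starProb (edgesAt G) a x e ≤ 1 := fun x =>
    (Finset.sum_le_sum_of_subset_of_nonneg (Finset.subset_univ F)
      fun e _ _ => starProb_nonneg _ _ _).trans_eq (sum_starProb (edgesAt_nonempty hc x) a)
  obtain ⟨x, hx⟩ := hΩ
  obtain ⟨y, hy⟩ : ∃ y, y ∉ Ω := by
    by_contra! h
    exact hΩ' (Finset.eq_univ_iff_forall.2 h)
  obtain ⟨p⟩ := hc.preconnected x y
  obtain ⟨d, -, hd1, hd2⟩ := p.exists_boundary_dart (Ω : Set V) hx hy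
  rw [h1, h2]
  refine Finset.sum_lt_sum (fun z _ => ?_) ⟨d.fst, Finset.mem_univ _, ?_⟩
  · split_ifs with hz
    · exact hle z
    · refine (Finset.sum_eq_zero fun e he => ?_).le
      rw [starProb, if_neg fun h => hz ((Finset.mem_filter.1 he).2 z ((mem_edgesAt G).1 h))]
  · rw [if_pos (Finset.mem_coe.1 hd1), ← sum_starProb (edgesAt_nonempty hc d.fst) a]
    refine Finset.sum_lt_sum_of_subset (Finset.subset_univ F)
      (i := ⟨s(d.fst, d.snd), d.adj⟩) (Finset.mem_univ _) ?_
      (starProb_pos ((mem_edgesAt G).2 (Sym2.mem_mk_left _ _)) a)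
      fun e _ _ => starProb_nonneg _ _ _
    intro h
    exact hd2 ((Finset.mem_filter.1 h).2 _ (Sym2.mem_mk_right _ _))

theorem densityCondition_iff_exists_load_eq [Nontrivial V] (hc : G.Connected) :
    DensityCondition G ↔
      ∃ a : G.edgeSet → ℝ, ∑ e, a e = 0 ∧ ∀ e, load (edgesAt G) a e = meanLoad V G.edgeSet :=
  have := nonempty_edgeSet hc
  ⟨fun h => (h.edgeDensityCondition hc).exists_load_eq (edgesAt_nonempty hc),
    fun ⟨_, _, ha⟩ => densityCondition_of_load_eq hc ha⟩

theorem IsConstantCurvatureWeight.densityCondition [Nontrivial V] (hc : G.Connected)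
    (hg : 6 ≤ G.egirth) {ω : G.edgeSet → ℝ} (h : IsConstantCurvatureWeight G ω) :
    DensityCondition G := by
  refine densityCondition_of_load_eq hc (a := logWeight ω) fun e => ?_
  have := h.2 e
  rw [edgeCurvature_eq hc hg h.1, avgCurvature_eq] at this
  linarith

theorem isConstantCurvatureWeight_exp (hc : G.Connected) (hg : 6 ≤ G.egirth) {a : G.edgeSet → ℝ}
    (h : ∀ e, load (edgesAt G) a e = meanLoad V G.edgeSet) :
    IsConstantCurvatureWeight G fun e => Real.exp (a e) := by
  refine ⟨fun e => Real.exp_pos _, fun e => ?_⟩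
  rw [edgeCurvature_eq hc hg fun e => Real.exp_pos _, logWeight_exp, h, avgCurvature_eq]

end Edges
end LinLuYau

namespace LinLuYau

theorem eq_initial_of_hasDerivAt_zero {f : ℝ → ℝ} (hf : ContinuousOn f (Set.Ici 0))
    (h : ∀ t, 0 < t → HasDerivAt f 0 t) {t : ℝ} (ht : 0 ≤ t) : f t = f 0 := by
  have h1 := antitoneOn_Ici_of_hasDerivAt hf h (fun _ _ => le_rfl) Set.self_mem_Ici ht ht
  have h2 := antitoneOn_Ici_of_hasDerivAt hf.neg (fun t ht => (h t ht).neg)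
    (fun _ _ => by simp) Set.self_mem_Ici ht ht
  exact le_antisymm h1 (neg_le_neg_iff.1 h2)

/-! ### Exponential convergence -/

section ConvergesExp

variable {ι κ : Type*} [Fintype ι] [Nonempty ι]

theorem ConvergesExp.nonneg_of_nonempty {u : ℝ → ι → ℝ} {l : ι → ℝ} {C c : ℝ}
    (h : ∀ t, 0 ≤ t → ∀ i, |u t i - l i| ≤ C * Real.exp (-(c * t))) : 0 ≤ C := by
  have := (abs_nonneg _).trans (h 0 le_rfl (Classical.arbitrary ι))
  simpa using this

/-- Exponential convergence is preserved by maps that are Lipschitz at the limit on bounded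
sets. -/
theorem ConvergesExp.comp {u : ℝ → ι → ℝ} {l : ι → ℝ} (h : ConvergesExp u l)
    {Φ : (ι → ℝ) → κ → ℝ}
    (hΦ : ∀ R, ∃ L, 0 ≤ L ∧ ∀ s, ‖s - l‖ ≤ R → ∀ k, |Φ s k - Φ l k| ≤ L * ‖s - l‖) :
    ConvergesExp (fun t => Φ (u t)) (Φ l) := by
  obtain ⟨C, c, hc, h⟩ := h
  have hC := ConvergesExp.nonneg_of_nonempty h
  obtain ⟨L, hL, hΦ⟩ := hΦ C
  have hn : ∀ t, 0 ≤ t → ‖u t - l‖ ≤ C * Real.exp (-(c * t)) := fun t ht =>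
    (pi_norm_le_iff_of_nonneg (by positivity)).2 (h t ht)
  refine ⟨L * C, c, hc, fun t ht k => ?_⟩
  have h1 : Real.exp (-(c * t)) ≤ 1 := Real.exp_le_one_iff.2 (by nlinarith)
  refine (hΦ _ ((hn t ht).trans (mul_le_of_le_one_right hC h1)) k).trans ?_
  rw [mul_assoc]
  exact mul_le_mul_of_nonneg_left (hn t ht) hL

theorem ConvergesExp.congr {u v : ℝ → κ → ℝ} {l : κ → ℝ} (h : ConvergesExp u l)
    (huv : ∀ t, 0 ≤ t → u t = v t) : ConvergesExp v l := by
  obtain ⟨C, c, hc, h⟩ := h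
  exact ⟨C, c, hc, fun t ht => huv t ht ▸ h t ht⟩

theorem abs_exp_sub_one_le (x : ℝ) : |Real.exp x - 1| ≤ |x| * Real.exp |x| := by
  rcases le_total 0 x with h | h
  · rw [abs_of_nonneg h, abs_of_nonneg (sub_nonneg.2 (Real.one_le_exp h))]
    have h1 := mul_le_mul_of_nonneg_right (Real.add_one_le_exp (-x)) (Real.exp_pos x).le
    rw [← Real.exp_add, neg_add_cancel, Real.exp_zero] at h1
    linarith
  · rw [abs_of_nonpos h, abs_of_nonpos (sub_nonpos.2 (Real.exp_le_one_iff.2 h))]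
    have h1 := Real.add_one_le_exp x
    have h2 : 1 ≤ Real.exp (-x) := Real.one_le_exp (neg_nonneg.2 h)
    nlinarith

theorem ConvergesExp.exp_add_const {u : ℝ → ι → ℝ} {l : ι → ℝ} (h : ConvergesExp u l) (b : ℝ) :
    ConvergesExp (fun t i => Real.exp (u t i + b)) (fun i => Real.exp (l i + b)) := by
  refine h.comp (Φ := fun s i => Real.exp (s i + b)) fun R => ?_
  refine ⟨(∑ i, Real.exp (l i + b)) * Real.exp R, by positivity, fun s hs i => ?_⟩
  have h1 : |s i - l i| ≤ ‖s - l‖ := norm_le_pi_norm (s - l) i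
  have h2 : Real.exp (s i + b) - Real.exp (l i + b) =
      Real.exp (l i + b) * (Real.exp (s i - l i) - 1) := by
    rw [mul_sub, ← Real.exp_add, mul_one]
    congr 2
    ring
  have h3 : Real.exp (l i + b) ≤ ∑ i, Real.exp (l i + b) :=
    Finset.single_le_sum (f := fun i => Real.exp (l i + b)) (fun _ _ => (Real.exp_pos _).le)
      (Finset.mem_univ i)
  rw [h2, abs_mul, abs_of_pos (Real.exp_pos _), mul_assoc]
  refine mul_le_mul h3 ((abs_exp_sub_one_le _).trans ?_) (abs_nonneg _) (by positivity)
  rw [mul_comm]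
  exact mul_le_mul (Real.exp_le_exp.2 (h1.trans hs)) h1 (abs_nonneg _) (Real.exp_pos _).le

/-- Normalization of a weight to total mass one, in logarithmic coordinates. -/
noncomputable def softmax (s : ι → ℝ) (i : ι) : ℝ := Real.exp (s i) / ∑ j, Real.exp (s j)

theorem sum_exp_pos (s : ι → ℝ) : 0 < ∑ j, Real.exp (s j) :=
  Finset.sum_pos (fun _ _ => Real.exp_pos _) Finset.univ_nonempty

theorem sum_softmax (s : ι → ℝ) : ∑ i, softmax s i = 1 := by
  simp only [softmax]
  rw [← Finset.sum_div]
  exact div_self (sum_exp_pos s).ne'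

theorem softmax_eq_exp (s : ι → ℝ) (i : ι) :
    softmax s i = Real.exp (s i + -Real.log (∑ j, Real.exp (s j))) := by
  rw [Real.exp_add, Real.exp_neg, Real.exp_log (sum_exp_pos s), softmax, div_eq_mul_inv]

theorem softmax_add_const (s : ι → ℝ) (c : ℝ) : softmax (fun i => s i + c) = softmax s := by
  funext i
  simp only [softmax, Real.exp_add, ← Finset.sum_mul]
  exact mul_div_mul_right _ _ (Real.exp_pos c).ne'

theorem ConvergesExp.softmax {u : ℝ → ι → ℝ} {l : ι → ℝ} (h : ConvergesExp u l) :
    ConvergesExp (fun t => softmax (u t)) (softmax l) := by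
  classical
  refine h.comp fun R => ⟨2, zero_le_two, fun s _ i => ?_⟩
  -- `softmax` is the share in a single star containing everything, so the Lipschitz bound for
  -- shares applies.
  have hs : ∀ s : ι → ℝ, LinLuYau.softmax s i = starProb (fun _ : Unit => Finset.univ) s () i :=
    fun s => by simp [LinLuYau.softmax, starProb, starMass]
  rw [hs, hs, abs_sub_le_iff]
  refine ⟨starProb_sub_le _ _ _ _, ?_⟩
  rw [norm_sub_rev]
  exact starProb_sub_le _ _ _ _

end ConvergesExp

/-! ### The three curvature flows -/

section Flows

variable {V : Type*} [Fintype V] [DecidableEq V] {G : SimpleGraph V} [DecidableRel G.Adj]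

/-- `F` is the field of the flow `(log ω)' = -2 (load - ρ) + ν(ω)` with common drift `ν`. -/
def IsDriftField (F : (G.edgeSet → ℝ) → G.edgeSet → ℝ) (ν : (G.edgeSet → ℝ) → ℝ) : Prop :=
  ∀ ω : G.edgeSet → ℝ, (∀ e, 0 < ω e) → ∀ e,
    F ω e = ω e * (-2 * (load (edgesAt G) (logWeight ω) e - meanLoad V G.edgeSet) + ν ω)

theorem isDriftField_constantCurvatureField (hc : G.Connected) (hg : 6 ≤ G.egirth) :
    IsDriftField (constantCurvatureField G) fun _ => 0 := fun ω hω e => by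
  rw [constantCurvatureField, edgeCurvature_eq hc hg hω, avgCurvature_eq]
  ring

theorem isDriftField_unnormalizedField (hc : G.Connected) (hg : 6 ≤ G.egirth) :
    IsDriftField (unnormalizedField G) fun _ => -avgCurvature G := fun ω hω e => by
  rw [unnormalizedField, edgeCurvature_eq hc hg hω, avgCurvature_eq]
  ring

theorem isDriftField_normalizedField (hc : G.Connected) (hg : 6 ≤ G.egirth) :
    IsDriftField (normalizedField G)
      fun ω => -avgCurvature G + ∑ h, edgeCurvature G ω h * ω h := fun ω hω e => by
  rw [normalizedField, edgeCurvature_eq hc hg hω e, avgCurvature_eq]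
  ring

theorem IsDriftField.isPositiveSolution {F : (G.edgeSet → ℝ) → G.edgeSet → ℝ}
    {ν : (G.edgeSet → ℝ) → ℝ} (hF : IsDriftField F ν) {ω₀ : G.edgeSet → ℝ}
    {σ : ℝ → G.edgeSet → ℝ} (h0 : ∀ e, Real.exp (σ 0 e) = ω₀ e)
    (hσ : ∀ t e, HasDerivAt (fun s => σ s e)
      (-2 * (load (edgesAt G) (σ t) e - meanLoad V G.edgeSet) +
        ν (fun e => Real.exp (σ t e))) t) :
    IsPositiveSolution F ω₀ fun t e => Real.exp (σ t e) where
  initial := funext h0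
  pos _ _ _ := Real.exp_pos _
  cont := continuousOn_pi.2 fun e t _ => (hσ t e).exp.continuousAt.continuousWithinAt
  deriv t _ e := by
    refine (hσ t e).exp.congr_deriv ?_
    rw [hF _ fun e => Real.exp_pos _, logWeight_exp]

theorem exp_logWeight {ω : G.edgeSet → ℝ} (hω : ∀ e, 0 < ω e) (e : G.edgeSet) :
    Real.exp (logWeight ω e) = ω e := Real.exp_log (hω e)

variable {F : (G.edgeSet → ℝ) → G.edgeSet → ℝ} {ν : (G.edgeSet → ℝ) → ℝ} {ω₀ : G.edgeSet → ℝ}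
  {ω : ℝ → G.edgeSet → ℝ}

theorem IsPositiveSolution.continuousOn_logWeight (h : IsPositiveSolution F ω₀ ω)
    (e : G.edgeSet) : ContinuousOn (fun t => logWeight (ω t) e) (Set.Ici 0) :=
  (continuousOn_pi.1 h.cont e).log fun t ht => (h.pos t ht e).ne'

theorem IsPositiveSolution.hasDerivAt_logWeight (h : IsPositiveSolution F ω₀ ω)
    (hF : IsDriftField F ν) {t : ℝ} (ht : 0 < t) (e : G.edgeSet) :
    HasDerivAt (fun t => logWeight (ω t) e)
      (-2 * (load (edgesAt G) (logWeight (ω t)) e - meanLoad V G.edgeSet) + ν (ω t)) t := by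
  have hp := (h.pos t ht.le e).ne'
  refine ((h.deriv t ht e).log hp).congr_deriv ?_
  rw [hF _ (h.pos t ht.le), mul_div_cancel_left₀ _ hp]

variable [Nontrivial V]

theorem IsPositiveSolution.isLoadFlow (h : IsPositiveSolution F ω₀ ω) (hF : IsDriftField F ν)
    (hc : G.Connected) : IsLoadFlow (edgesAt G) fun t => centered (logWeight (ω t)) :=
  have := nonempty_edgeSet hc
  IsLoadFlow.of_drift (edgesAt_nonempty hc) h.continuousOn_logWeight
    fun _ ht e => h.hasDerivAt_logWeight hF ht e

theorem IsPositiveSolution.continuousOn_mean (h : IsPositiveSolution F ω₀ ω) :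
    ContinuousOn (fun t => (∑ e, logWeight (ω t) e) / Fintype.card G.edgeSet) (Set.Ici 0) :=
  (continuousOn_finsetSum _ fun e _ => h.continuousOn_logWeight e).div_const _

/-- The load deviations sum to zero, so the mean logarithm feels only the common drift. -/
theorem IsPositiveSolution.hasDerivAt_mean (h : IsPositiveSolution F ω₀ ω)
    (hF : IsDriftField F ν) (hc : G.Connected) {t : ℝ} (ht : 0 < t) :
    HasDerivAt (fun t => (∑ e, logWeight (ω t) e) / Fintype.card G.edgeSet) (ν (ω t)) t := by
  have := nonempty_edgeSet hc
  refine ((HasDerivAt.fun_sum (u := Finset.univ) fun e (_ : e ∈ Finset.univ) =>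
    h.hasDerivAt_logWeight hF ht e).div_const _).congr_deriv ?_
  have hE : (Fintype.card G.edgeSet : ℝ) ≠ 0 := Nat.cast_ne_zero.2 Fintype.card_ne_zero
  rw [Finset.sum_add_distrib, ← Finset.mul_sum, sum_load_sub_meanLoad (edgesAt_nonempty hc)]
  simp only [Finset.sum_const, Finset.card_univ, nsmul_eq_mul]
  field_simp
  ring

theorem IsPositiveSolution.convergesExp_centered (h : IsPositiveSolution F ω₀ ω)
    (hF : IsDriftField F ν) (hc : G.Connected) {a : G.edgeSet → ℝ} (ha : ∑ e, a e = 0)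
    (hload : ∀ e, load (edgesAt G) a e = meanLoad V G.edgeSet) :
    ConvergesExp (fun t => centered (logWeight (ω t))) a :=
  have := nonempty_edgeSet hc
  (h.isLoadFlow hF hc).exists_abs_sub_le_exp (edgesAt_nonempty hc) (reflTransGen_edgesAt hc) ha
    hload

/-- The curvature converges exponentially to a constant exactly under the density condition. -/
theorem IsPositiveSolution.convergesExp_edgeCurvature_iff (h : IsPositiveSolution F ω₀ ω)
    (hF : IsDriftField F ν) (hc : G.Connected) (hg : 6 ≤ G.egirth) :
    ConvergesExp (fun t => edgeCurvature G (ω t)) (fun _ => avgCurvature G) ↔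
      DensityCondition G := by
  have := nonempty_edgeSet hc
  have hκ : ∀ t, 0 ≤ t → ∀ e, edgeCurvature G (ω t) e - avgCurvature G =
      2 * (load (edgesAt G) (centered (logWeight (ω t))) e - meanLoad V G.edgeSet) :=
    fun t ht e => by
      rw [edgeCurvature_eq hc hg (h.pos t ht), avgCurvature_eq, load_centered]
      ring
  constructor
  · rintro ⟨C, c, hc', hC⟩
    obtain ⟨a, ha⟩ := (h.isLoadFlow hF hc).exists_load_eq (C := C) hc' fun t ht e => by
      have := hC t ht e
      rw [hκ t ht, abs_mul, abs_two] at this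
      linarith [abs_nonneg
        (load (edgesAt G) (centered (logWeight (ω t))) e - meanLoad V G.edgeSet)]
    exact densityCondition_of_load_eq hc ha
  · intro hd
    obtain ⟨a, ha, hload⟩ := (densityCondition_iff_exists_load_eq hc).1 hd
    have hconv := (h.convergesExp_centered hF hc ha hload).comp (Φ := load (edgesAt G))
      fun R => ⟨2 * Fintype.card V, by positivity, fun s _ e => abs_load_sub_le s a e⟩
    obtain ⟨C, c, hc', hC⟩ := hconv
    refine ⟨2 * C, c, hc', fun t ht e => ?_⟩
    have := hC t ht e
    rw [hload] at this
    rw [hκ t ht, abs_mul, abs_two]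
    linarith

theorem exp_mean_add_centered {ω : G.edgeSet → ℝ} (hω : ∀ e, 0 < ω e) (e : G.edgeSet) :
    Real.exp (centered (logWeight ω) e + (∑ f, logWeight ω f) / Fintype.card G.edgeSet) = ω e := by
  rw [centered, neg_add_cancel_right, exp_logWeight hω]

/-! ### The constant curvature flow -/

theorem exists_isPositiveSolution_constantCurvatureField (hc : G.Connected) (hg : 6 ≤ G.egirth)
    (hω₀ : ∀ e, 0 < ω₀ e) : ∃ ω, IsPositiveSolution (constantCurvatureField G) ω₀ ω := by
  obtain ⟨s, h0, hs⟩ := exists_logFlow (edgesAt G) (logWeight ω₀)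
  refine ⟨_, (isDriftField_constantCurvatureField hc hg).isPositiveSolution (σ := s)
    (fun e => by rw [h0, exp_logWeight hω₀]) fun t e => ?_⟩
  rw [add_zero]
  exact hs t e

theorem constantCurvatureFlow_converges_iff (hc : G.Connected) (hg : 6 ≤ G.egirth)
    (h : IsPositiveSolution (constantCurvatureField G) ω₀ ω) :
    (∃ ωlim, IsConstantCurvatureWeight G ωlim ∧ ConvergesExp ω ωlim) ↔ DensityCondition G := by
  have := nonempty_edgeSet hc
  refine ⟨fun ⟨_, hlim, _⟩ => hlim.densityCondition hc hg, fun hd => ?_⟩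
  have hF := isDriftField_constantCurvatureField hc hg
  obtain ⟨a, ha, hload⟩ := (densityCondition_iff_exists_load_eq hc).1 hd
  -- Without drift the mean logarithm `b` is conserved; restoring it to the centred limit `a` gives
  -- the limit weight.
  have hmean := fun t (ht : 0 ≤ t) => eq_initial_of_hasDerivAt_zero h.continuousOn_mean
    (fun t ht => h.hasDerivAt_mean hF hc ht) ht
  set b := (∑ e, logWeight (ω 0) e) / Fintype.card G.edgeSet
  refine ⟨fun e => Real.exp (a e + b), isConstantCurvatureWeight_exp hc hg fun e => ?_,
    ((h.convergesExp_centered hF hc ha hload).exp_add_const b).congr fun t ht => funext fun e => ?_⟩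
  · rw [load_add_const, hload]
  · rw [← hmean t ht]
    exact exp_mean_add_centered (h.pos t ht) e

/-! ### The unnormalized flow -/

theorem exists_isPositiveSolution_unnormalizedField (hc : G.Connected) (hg : 6 ≤ G.egirth)
    (hω₀ : ∀ e, 0 < ω₀ e) : ∃ ω, IsPositiveSolution (unnormalizedField G) ω₀ ω := by
  obtain ⟨s, h0, hs⟩ := exists_logFlow (edgesAt G) (logWeight ω₀)
  refine ⟨_, (isDriftField_unnormalizedField hc hg).isPositiveSolution
    (σ := fun t e => s t e + t * -avgCurvature G)
    (fun e => by rw [h0, zero_mul, add_zero, exp_logWeight hω₀]) fun t e => ?_⟩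
  rw [load_add_const]
  exact (hs t e).add (hasDerivAt_mul_const _)

/-! ### The normalized flow -/

theorem sum_edgeCurvature_mul (hc : G.Connected) (hg : 6 ≤ G.egirth) {ω : G.edgeSet → ℝ}
    (hω : ∀ e, 0 < ω e) (hsum : ∑ e, ω e = 1) :
    ∑ e, ω e * (-2 * (load (edgesAt G) (logWeight ω) e - meanLoad V G.edgeSet)) =
      avgCurvature G - ∑ e, edgeCurvature G ω e * ω e := by
  rw [← mul_one (avgCurvature G), ← hsum, Finset.mul_sum, ← Finset.sum_sub_distrib]
  refine Finset.sum_congr rfl fun e _ => ?_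
  rw [edgeCurvature_eq hc hg hω, avgCurvature_eq]
  ring

theorem exists_isPositiveSolution_normalizedField (hc : G.Connected) (hg : 6 ≤ G.egirth)
    (hω₀ : ∀ e, 0 < ω₀ e) (hsum : ∑ e, ω₀ e = 1) :
    ∃ ω, IsPositiveSolution (normalizedField G) ω₀ ω := by
  have := nonempty_edgeSet hc
  obtain ⟨s, h0, hs⟩ := exists_logFlow (edgesAt G) (logWeight ω₀)
  -- Divide the driftless flow by its total mass. The derivative of the logarithm of that mass
  -- supplies exactly the drift, by `sum_edgeCurvature_mul` for the normalized weight.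
  refine ⟨_, (isDriftField_normalizedField hc hg).isPositiveSolution
    (σ := fun t e => s t e + -Real.log (∑ f, Real.exp (s t f)))
    (fun e => by simp [h0, exp_logWeight hω₀, hsum]) fun t e => ?_⟩
  have hlog := ((HasDerivAt.fun_sum (u := Finset.univ) fun f (_ : f ∈ Finset.univ) =>
    (hs t f).exp).log (sum_exp_pos (s t)).ne').neg
  rw [load_add_const]
  refine ((hs t e).add hlog).congr_deriv ?_
  congr 1
  have key := sum_edgeCurvature_mul hc hg (ω := softmax (s t))
    (fun e => div_pos (Real.exp_pos _) (sum_exp_pos (s t))) (sum_softmax (s t))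
  have hload : ∀ f, load (edgesAt G) (logWeight (softmax (s t))) f = load (edgesAt G) (s t) f :=
    fun f => by
      rw [funext (softmax_eq_exp (s t)), logWeight_exp, load_add_const]
  simp only [hload] at key
  simp only [← softmax_eq_exp]
  have hdiv : (∑ f, Real.exp (s t f) *
      (-2 * (load (edgesAt G) (s t) f - meanLoad V G.edgeSet))) / ∑ f, Real.exp (s t f) =
      ∑ f, softmax (s t) f * (-2 * (load (edgesAt G) (s t) f - meanLoad V G.edgeSet)) := by
    rw [Finset.sum_div]
    refine Finset.sum_congr rfl fun f _ => ?_
    rw [softmax]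
    ring
  rw [hdiv, key]
  ring

/-- The normalized flow preserves total mass one. -/
theorem normalizedFlow_sum_eq_one (hc : G.Connected) (hg : 6 ≤ G.egirth)
    (hsum : ∑ e, ω₀ e = 1) (h : IsPositiveSolution (normalizedField G) ω₀ ω) {t : ℝ}
    (ht : 0 ≤ t) : ∑ e, ω t e = 1 := by
  have hF := isDriftField_normalizedField hc hg
  -- The mass $M$ satisfies $(M-1)'=(M-1)\sum_h\kappa_h\omega_h$, and `θ` is a ready-made
  -- antiderivative of the coefficient, so $(M-1)e^{-\theta}$ is constant.
  set θ : ℝ → ℝ := fun t =>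
    (∑ e, logWeight (ω t) e) / Fintype.card G.edgeSet + t * avgCurvature G
  have hθc : ContinuousOn θ (Set.Ici 0) := h.continuousOn_mean.add (by fun_prop)
  have hθ : ∀ t, 0 < t → HasDerivAt θ (∑ e, edgeCurvature G (ω t) e * ω t e) t := fun t ht => by
    refine ((h.hasDerivAt_mean hF hc ht).add (hasDerivAt_mul_const _)).congr_deriv ?_
    ring
  have key := eq_initial_of_hasDerivAt_zero
    (f := fun t => (∑ e, ω t e - 1) * Real.exp (-θ t))
    (((continuousOn_finsetSum _ fun e _ => continuousOn_pi.1 h.cont e).sub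
      continuousOn_const).mul hθc.neg.rexp) (fun t ht => ?_) ht
  · simp only [h.initial, hsum, sub_self, zero_mul, mul_eq_zero, (Real.exp_pos _).ne', or_false]
      at key
    linarith
  · refine (((HasDerivAt.fun_sum (u := Finset.univ) fun e (_ : e ∈ Finset.univ) =>
      h.deriv t ht e).sub_const 1).mul (hθ t ht).neg.exp).congr_deriv ?_
    simp only [normalizedField, Finset.sum_add_distrib, Finset.sum_neg_distrib, ← Finset.sum_mul]
    have hcomm : ∑ e, ω t e * edgeCurvature G (ω t) e = ∑ e, edgeCurvature G (ω t) e * ω t e :=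
      Finset.sum_congr rfl fun e _ => mul_comm _ _
    rw [hcomm]
    simp only [Pi.neg_apply]
    ring

theorem normalizedFlow_converges_iff (hc : G.Connected) (hg : 6 ≤ G.egirth)
    (hsum : ∑ e, ω₀ e = 1) (h : IsPositiveSolution (normalizedField G) ω₀ ω) :
    (∃ ωlim, IsConstantCurvatureWeight G ωlim ∧ ∑ e, ωlim e = 1 ∧ ConvergesExp ω ωlim) ↔
      DensityCondition G := by
  have := nonempty_edgeSet hc
  refine ⟨fun ⟨_, hlim, _⟩ => hlim.densityCondition hc hg, fun hd => ?_⟩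
  have hF := isDriftField_normalizedField hc hg
  obtain ⟨a, ha, hload⟩ := (densityCondition_iff_exists_load_eq hc).1 hd
  -- `softmax` forgets the centring and, since the mass stays one, recovers `ω t` from its
  -- logarithm.
  refine ⟨softmax a, ?_, sum_softmax a,
    (h.convergesExp_centered hF hc ha hload).softmax.congr fun t ht => ?_⟩
  · rw [funext (softmax_eq_exp a)]
    exact isConstantCurvatureWeight_exp hc hg fun e => by rw [load_add_const, hload]
  · have h1 := softmax_add_const (logWeight (ω t))
      (-((∑ f, logWeight (ω t) f) / Fintype.card G.edgeSet))
    refine h1.trans (funext fun e => ?_)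
    simp only [softmax, exp_logWeight (h.pos t ht), normalizedFlow_sum_eq_one hc hg hsum h ht,
      div_one]

end Flows

end LinLuYau

theorem corollary3 {V : Type*} [Fintype V] [DecidableEq V] [Nontrivial V]
    (G : SimpleGraph V) [DecidableRel G.Adj] (hconn : G.Connected) (hgirth : 6 ≤ G.egirth) :
    -- the average curvature of every positive weight is the constant `κ̄`
    (∀ ω : G.edgeSet → ℝ, (∀ e, 0 < ω e) →
      (∑ e, LinLuYau.edgeCurvature G ω e) / (G.edgeFinset.card : ℝ) = LinLuYau.avgCurvature G) ∧
    -- the flow `dω/dt = -(κ - κ̄) ω`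
    (∀ ω₀ : G.edgeSet → ℝ, (∀ e, 0 < ω₀ e) →
      (∃ ω, LinLuYau.IsPositiveSolution (LinLuYau.constantCurvatureField G) ω₀ ω) ∧
      ∀ ω, LinLuYau.IsPositiveSolution (LinLuYau.constantCurvatureField G) ω₀ ω →
        ((∃ ωlim, LinLuYau.IsConstantCurvatureWeight G ωlim ∧ LinLuYau.ConvergesExp ω ωlim) ↔
          LinLuYau.DensityCondition G)) ∧
    -- the unnormalized flow `dω/dt = -κ ω`
    (∀ ω₀ : G.edgeSet → ℝ, (∀ e, 0 < ω₀ e) →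
      (∃ ω, LinLuYau.IsPositiveSolution (LinLuYau.unnormalizedField G) ω₀ ω) ∧
      ∀ ω, LinLuYau.IsPositiveSolution (LinLuYau.unnormalizedField G) ω₀ ω →
        (LinLuYau.ConvergesExp (fun t => LinLuYau.edgeCurvature G (ω t))
            (fun _ => LinLuYau.avgCurvature G) ↔
          LinLuYau.DensityCondition G)) ∧
    -- the normalized flow `dω/dt = -κ ω + ω ∑ κ ω`, on weights of total mass one
    (∀ ω₀ : G.edgeSet → ℝ, (∀ e, 0 < ω₀ e) → ∑ e, ω₀ e = 1 →
      (∃ ω, LinLuYau.IsPositiveSolution (LinLuYau.normalizedField G) ω₀ ω) ∧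
      ∀ ω, LinLuYau.IsPositiveSolution (LinLuYau.normalizedField G) ω₀ ω →
        ((∃ ωlim, LinLuYau.IsConstantCurvatureWeight G ωlim ∧ ∑ e, ωlim e = 1 ∧
            LinLuYau.ConvergesExp ω ωlim) ↔ LinLuYau.DensityCondition G) ∧
        (LinLuYau.ConvergesExp (fun t => LinLuYau.edgeCurvature G (ω t))
            (fun _ => LinLuYau.avgCurvature G) ↔
          LinLuYau.DensityCondition G)) := by
  refine ⟨fun ω hω => LinLuYau.sum_edgeCurvature_div_card hconn hgirth hω,
    fun ω₀ hω₀ => ⟨LinLuYau.exists_isPositiveSolution_constantCurvatureField hconn hgirth hω₀,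
      fun ω h => LinLuYau.constantCurvatureFlow_converges_iff hconn hgirth h⟩,
    fun ω₀ hω₀ => ⟨LinLuYau.exists_isPositiveSolution_unnormalizedField hconn hgirth hω₀,
      fun ω h => h.convergesExp_edgeCurvature_iff
        (LinLuYau.isDriftField_unnormalizedField hconn hgirth) hconn hgirth⟩,
    fun ω₀ hω₀ hsum =>
      ⟨LinLuYau.exists_isPositiveSolution_normalizedField hconn hgirth hω₀ hsum,
        fun ω h => ⟨LinLuYau.normalizedFlow_converges_iff hconn hgirth hsum h,
          h.convergesExp_edgeCurvature_iff
            (LinLuYau.isDriftField_normalizedField hconn hgirth) hconn hgirth⟩⟩⟩
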